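/- Let $\mathfrak g$ be a finite-dimensional complex simple Lie algebra, $\mathfrak h$ a Cartan subalgebra, $\Delta$ the set of roots and $\Pi=\{\alpha_1,\dots,\alpha_\ell\}$ a choice of simple roots. For $\varphi\in\Delta$ write $\varphi=\sum_i n_i(\varphi)\alpha_i$ with $n_i(\varphi)\in\mathbb Z$, and let $\psi$ be the highest root. Let $x_1,\dots,x_\ell\in\mathfrak h$ be the basis dual to $\Pi$, so that $\langle\alpha_i,x_j\rangle=\delta_{ij}$. Fix $j\in\{1,\dots,\ell\}$. Let $\mathfrak q[j]$ be the maximal standard parabolic subalgebra defined by $x_j$ (the sum of the eigenspaces of $\operatorname{ad}x_j$ with nonnegative eigenvalues), $\mathfrak n[j]$ its nilradical, $\mathfrak m[j]$ the centralizer of $x_j$ in $\mathfrak g$ (the Levi factor of $\mathfrak q[j]$ containing $\mathfrak h$), and $\mathfrak t[j]$ the center of $\mathfrak m[j]$, which is contained in $\mathfrak h$. For $\mu\in\mathfrak t[j]^*$ put $\mathfrak g_\mu=\{z\in\mathfrak g : [x,z]=\mu(x)z\ \text{for all } x\in\mathfrak t[j]\}$. Let $R[j]$ be the set of $\mathfrak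 t[j]$-roots, i.e. of the nonzero $\nu\in\mathfrak t[j]^*$ with $\mathfrak g_\nu\ne0$; let $R[j]_+$ be the set of those $\nu\in R[j]$ with $\mathfrak g_\nu\subseteq\mathfrak n[j]$, and $R[j]_{\rm simp}$ the set of those $\nu\in R[j]_+$ that are not a sum of two elements of $R[j]_+$. Let $\beta[j]=\alpha_j|_{\mathfrak t[j]}$ and $I[j]=\{\pm1,\dots,\pm n_j(\psi)\}$. Then: 1. $R[j]_{\rm simp}=\{\beta[j]\}$, $R[j]_+=\{k\beta[j] : 1\le k\le n_j(\psi)\}$ and $R[j]=\{k\beta[j] : k\in I[j]\}$; in particular $|R[j]_+|=n_j(\psi)$ and $|R[j]|=2n_j(\psi)$. 2. For every $k\in I[j]$ the space $\mathfrak g_{k\beta[j]}$ is an irreducible $\operatorname{ad}\mathfrak m[j]$-module. 3. As an $\operatorname{ad}\mathfrak m[j]$-module, $\mathfrak n[j]$ is multiplicity-free (a direct sum of pairwise inequivalent irreducible modules) with exactly $n_j(\psi)$ irreducible components. 4. As an $\operatorname{ad}\mathfrak m[j]$-module, $\mathfrak g/\mathfrak m[j]$ is multiplicity-free with exactly $2n_j(\psi)$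 irreducible components. 5. If $p,q\in I[j]$ and $p+q\in I[j]$, then $[\mathfrak g_{p\beta[j]},\mathfrak g_{q\beta[j]}]=\mathfrak g_{(p+q)\beta[j]}$, where the left-hand side is the linear span of the brackets. -/

import Mathlib

open LieAlgebra LieAlgebra.IsKilling

namespace TRoots

noncomputable section

/-! ### Multiplicity-free modules and brackets of subspaces -/

/-- A module over a complex Lie algebra is multiplicity-free with `N` irreducible components if it
is the (internal) direct sum of `N` irreducible submodules that are pairwise non-isomorphic. -/
def IsMultiplicityFreeWith (A V : Type*) [LieRing A] [LieAlgebra ℂ A]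
    [AddCommGroup V] [Module ℂ V] [LieRingModule A V] [LieModule ℂ A V] (N : ℕ) : Prop :=
  ∃ W : Fin N → LieSubmodule ℂ A V,
    iSupIndep W ∧ (⨆ i, W i) = ⊤ ∧
    (∀ i, LieModule.IsIrreducible ℂ A (W i)) ∧
    ∀ i i', i ≠ i' → IsEmpty (W i ≃ₗ⁅ℂ, A⁆ W i')

/-- The linear span `[U, V]` of all brackets `[u, v]`, for linear subspaces `U`, `V`. -/
def bracketSpan {L : Type*} [LieRing L] [LieAlgebra ℂ L] (U V : Submodule ℂ L) :
    Submodule ℂ L :=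
  Submodule.span ℂ {z | ∃ u ∈ U, ∃ v ∈ V, ⁅u, v⁆ = z}

/-! ### The nilradical -/

/-- The nilradical of a Lie algebra: its largest ideal that is nilpotent as a Lie algebra. -/
def nilradical (A : Type*) [LieRing A] [LieAlgebra ℂ A] : LieIdeal ℂ A :=
  sSup {I : LieIdeal ℂ A | LieRing.IsNilpotent I}

/-- The nilradical of a subalgebra `q` of `L`, regarded as an `ad m`-submodule of `L` for a
subalgebra `m` of `q`. -/
def nilradicalAsSubmodule {L : Type*} [LieRing L] [LieAlgebra ℂ L] (q m : LieSubalgebra ℂ L)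
    (hmq : m ≤ q) : LieSubmodule ℂ m L :=
  { Submodule.map (q : Submodule ℂ L).subtype (nilradical q : Submodule ℂ q) with
    lie_mem := by
      rintro y z ⟨w, hw, rfl⟩
      exact ⟨⁅(⟨(y : L), hmq y.2⟩ : q), w⁆, lie_mem_right ℂ q (nilradical q) _ w hw, rfl⟩ }

/-! ### Weights of the center `t` of a subalgebra `m` -/

section Center

variable {L : Type*} [LieRing L] [LieAlgebra ℂ L] (m : LieSubalgebra ℂ L)

/-- The weight space `g_μ` in `g = L`, for a linear form `μ` on the center `t` of `m`. It is an
`ad m`-submodule of `L`. -/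
def weightSpace (μ : Module.Dual ℂ (center ℂ m)) : LieSubmodule ℂ m L where
  carrier := {z | ∀ x : center ℂ m, ⁅((x : m) : L), z⁆ = μ x • z}
  add_mem' := fun {z w} hz hw x => by rw [lie_add, hz x, hw x, smul_add]
  zero_mem' := fun x => by simp
  smul_mem' := fun c z hz x => by rw [lie_smul, hz x, smul_comm]
  lie_mem := fun {y z} hz x => by
    have hxy : ⁅((x : m) : L), (y : L)⁆ = 0 := by
      have h : ⁅y, (x : m)⁆ = 0 := x.2 y
      rw [← lie_skew, neg_eq_zero]
      simpa using congrArg (Subtype.val : m → L) h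
    change ⁅((x : m) : L), ⁅(y : L), z⁆⁆ = μ x • ⁅(y : L), z⁆
    have hz' : ⁅((x : m) : L), z⁆ = μ x • z := hz x
    rw [leibniz_lie, hxy, zero_lie, zero_add, hz', lie_smul]

/-- The set `R` of `t`-roots: the nonzero weights of the center `t` of `m` in `L`. -/
def roots : Set (Module.Dual ℂ (center ℂ m)) :=
  {ν | ν ≠ 0 ∧ weightSpace m ν ≠ ⊥}

/-- The positive `t`-roots `R₊`: those whose root space lies in the given `ad m`-submodule `n`
(which is going to be the nilradical of the parabolic subalgebra). -/
def posRoots (n : LieSubmodule ℂ m L) : Set (Module.Dual ℂ (center ℂ m)) :=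
  {ν | ν ∈ roots m ∧ weightSpace m ν ≤ n}

/-- The simple `t`-roots: the positive ones that are not a sum of two positive ones. -/
def simpleRoots (n : LieSubmodule ℂ m L) : Set (Module.Dual ℂ (center ℂ m)) :=
  {ν | ν ∈ posRoots m n ∧ ¬ ∃ ν₁ ∈ posRoots m n, ∃ ν₂ ∈ posRoots m n, ν = ν₁ + ν₂}

end Center

/-! ### Maximal parabolic subalgebras of a simple Lie algebra -/

section Simple

variable {L : Type*} [LieRing L] [LieAlgebra ℂ L] [FiniteDimensional ℂ L]
  [LieAlgebra.IsSimple ℂ L] {H : LieSubalgebra ℂ L} [H.IsCartanSubalgebra]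
  (b : (rootSystem H).Base)

/-- The integer `n_j(φ)`: the coefficient of the simple root `α_j` in the root `φ`. -/
def coeff (φ : H.root) (j : b.support) : ℤ :=
  b.toWeightBasisInt.repr ((rootSystem H).rootSpanMem ℤ φ) j

/-- `ψ` is the highest root: it is maximal for the order on roots in which `ψ ≤ φ` means that
`φ - ψ` is a sum of simple roots. -/
def IsHighestRoot (ψ : H.root) : Prop :=
  ∀ φ : H.root,
    (rootSystem H).root φ - (rootSystem H).root ψ ∈
      AddSubmonoid.closure ((rootSystem H).root '' b.support) → φ = ψ

/-- The element `x_j` of the Cartan subalgebra: the member with index `j` of the basis dual to the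
basis of simple roots. -/
def dualElt (j : b.support) : H :=
  (Module.evalEquiv ℂ H).symm (b.toWeightBasis.coord j)

open Classical in
/-- The defining property `⟨α_i, x_j⟩ = δ_ij`. -/
lemma root_dualElt (i j : b.support) :
    (rootSystem H).root i (dualElt b j) = if i = j then 1 else 0 := by
  rw [dualElt, Module.apply_evalEquiv_symm_apply, Module.Basis.coord_apply,
    RootPairing.Base.toWeightBasis_repr_root, Finsupp.single_apply]

/-- The standard Levi factor `m[j]`: the centralizer of `x_j` in `L`. -/
def levi (j : b.support) : LieSubalgebra ℂ L where
  carrier := {z | ⁅(dualElt b j : L), z⁆ = 0}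
  add_mem' := fun {z w} hz hw => by
    have hz' : ⁅(dualElt b j : L), z⁆ = 0 := hz
    have hw' : ⁅(dualElt b j : L), w⁆ = 0 := hw
    change ⁅(dualElt b j : L), z + w⁆ = 0
    rw [lie_add, hz', hw', add_zero]
  zero_mem' := lie_zero _
  smul_mem' := fun c z hz => by
    have hz' : ⁅(dualElt b j : L), z⁆ = 0 := hz
    change ⁅(dualElt b j : L), c • z⁆ = 0
    rw [lie_smul, hz', smul_zero]
  lie_mem' := fun {z w} hz hw => by
    have hz' : ⁅(dualElt b j : L), z⁆ = 0 := hz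
    have hw' : ⁅(dualElt b j : L), w⁆ = 0 := hw
    change ⁅(dualElt b j : L), ⁅z, w⁆⁆ = 0
    rw [leibniz_lie, hz', hw', zero_lie, lie_zero, add_zero]

/-- The eigenspace of `ad x_j` for the eigenvalue `k`. -/
def grade (j : b.support) (k : ℕ) : Submodule ℂ L :=
  Module.End.eigenspace (ad ℂ L (dualElt b j : L)) (k : ℂ)

lemma mem_grade {j : b.support} {k : ℕ} {z : L} :
    z ∈ grade b j k ↔ ⁅(dualElt b j : L), z⁆ = (k : ℂ) • z := by
  simp [grade]

/-- The maximal standard parabolic subalgebra `q[j]` defined by `x_j`: the sum of the eigenspaces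
of `ad x_j` with nonnegative eigenvalues. (All the eigenvalues are integers.) -/
def parabolic (j : b.support) : LieSubalgebra ℂ L :=
  { (⨆ k : ℕ, grade b j k : Submodule ℂ L) with
    lie_mem' := by
      intro z w hz hw
      change z ∈ (⨆ k : ℕ, grade b j k : Submodule ℂ L) at hz
      change w ∈ (⨆ k : ℕ, grade b j k : Submodule ℂ L) at hw
      change ⁅z, w⁆ ∈ (⨆ k : ℕ, grade b j k : Submodule ℂ L)
      induction hz using Submodule.iSup_induction' with
      | zero => rw [zero_lie]; exact Submodule.zero_mem _
      | add z₁ z₂ _ _ h₁ h₂ => rw [add_lie]; exact Submodule.add_mem _ h₁ h₂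
      | mem k z hz =>
        induction hw using Submodule.iSup_induction' with
        | zero => rw [lie_zero]; exact Submodule.zero_mem _
        | add w₁ w₂ _ _ h₁ h₂ => rw [lie_add]; exact Submodule.add_mem _ h₁ h₂
        | mem l w hw =>
          refine Submodule.mem_iSup_of_mem (k + l) ?_
          rw [mem_grade] at hz hw ⊢
          rw [leibniz_lie, hz, hw, smul_lie, lie_smul, Nat.cast_add, add_smul] }

lemma levi_le_parabolic (j : b.support) : levi b j ≤ parabolic b j := by
  intro z hz
  have hz' : ⁅(dualElt b j : L), z⁆ = 0 := hz
  change z ∈ (⨆ k : ℕ, grade b j k : Submodule ℂ L)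
  refine Submodule.mem_iSup_of_mem 0 ?_
  rw [mem_grade, hz', Nat.cast_zero, zero_smul]

/-- The nilradical `n[j]` of `q[j]`, as an `ad m[j]`-submodule of `L`. -/
def nil (j : b.support) : LieSubmodule ℂ (levi b j) L :=
  nilradicalAsSubmodule (parabolic b j) (levi b j) (levi_le_parabolic b j)

lemma cartan_le_levi (j : b.support) : H ≤ levi b j := by
  intro z hz
  change ⁅(dualElt b j : L), z⁆ = 0
  have h : ⁅dualElt b j, (⟨z, hz⟩ : H)⁆ = 0 := trivial_lie_zero _ _ _ _
  simpa using congrArg (Subtype.val : H → L) h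

lemma center_levi_le_cartan (j : b.support) (x : center ℂ (levi b j)) :
    ((x : levi b j) : L) ∈ H := by
  have hn := LieSubalgebra.IsCartanSubalgebra.self_normalizing (H := H)
  refine hn.le ((LieSubalgebra.mem_normalizer_iff' H _).mpr fun y hy => ?_)
  have h : ⁅(⟨y, cartan_le_levi b j hy⟩ : levi b j), (x : levi b j)⁆ = 0 := x.2 _
  have h' : ⁅y, ((x : levi b j) : L)⁆ = 0 := by
    simpa using congrArg (Subtype.val : levi b j → L) h
  rw [h']
  exact H.zero_mem

/-- The inclusion of the center `t[j]` of `m[j]` into the Cartan subalgebra. -/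
def centerToCartan (j : b.support) : center ℂ (levi b j) →ₗ[ℂ] H where
  toFun x := ⟨((x : levi b j) : L), center_levi_le_cartan b j x⟩
  map_add' _ _ := rfl
  map_smul' _ _ := rfl

/-- The `t[j]`-component `β[j]` of the simple root `α_j`, i.e. the restriction of `α_j` to
`t[j]`. -/
def beta (j : b.support) : Module.Dual ℂ (center ℂ (levi b j)) :=
  ((rootSystem H).root j).comp (centerToCartan b j)

/-- The index set `I[j] = {±1, …, ±n_j(ψ)}`. -/
def indexSet (ψ : H.root) (j : b.support) : Set ℤ :=
  {k | k ≠ 0 ∧ |k| ≤ coeff b ψ j}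

/-- The space `g_{kβ[j]}`. -/
def betaSpace (j : b.support) (k : ℤ) : LieSubmodule ℂ (levi b j) L :=
  weightSpace (levi b j) (k • beta b j)

end Simple

end

end TRoots

/-! The centre `t[j]` is the line through `x_j`: a central element lies in `H` and commutes with the
root vectors of every `α_i`, `i ≠ j`, so these `α_i` vanish on it. Hence `t[j]`-weight spaces are
eigenspaces of `ad x_j`. On the root space of `φ` the eigenvalue is `n_j(φ)`, so for `k ≠ 0` the
space `g_{kβ}` is the sum of the root spaces with `n_j(φ) = k`. Everything becomes a question about
the levels `{φ | n_j(φ) = k}` of the root system.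

The combinatorial core is `pairingIn_pos_of_dominant`: two roots on levels of the same sign, each
dominant for the simple roots other than `α_j`, have positive pairing, so their difference is a root
if they are distinct. With both roots on one level this shows that the level is connected under
addition of roots of level zero (`mem_of_rootCoeff_eq`). Since `[g_α, g_β] ≠ 0` whenever `α + β` is
a root, and root spaces are lines, a nonzero `m[j]`-submodule of `g_{kβ}` is everything. With roots
on the levels `p` and `p + q` it shows that the bracket of `g_{pβ}` and `g_{qβ}` is nonzero
(`exists_root_sub_root`); by irreducibility it fills `g_{(p+q)β}`.

The levels that occur are bounded by `n_j(ψ)`, because an irreducible root system has a unique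
maximal root, and there are no gaps, because a positive root is built by adding simple roots one at
a time. Distinct levels are inequivalent modules, as `x_j` acts on them by distinct scalars.
Finally, the nilradical, defined abstractly as the largest nilpotent ideal, is identified with the
sum of the positive levels (`mem_nil`). -/

/-! ### An inequality for obtuse bases -/

/-- If two lattice vectors are dominant with respect to the members of an obtuse basis which are
involved in their difference, then their inner product is at least the square length of their
coordinatewise minimum. -/
lemma Module.Basis.form_inf_le_of_dominant {κ Λ : Type*} [Fintype κ] [AddCommGroup Λ]
    (e : Module.Basis κ ℤ Λ) (B : LinearMap.BilinForm ℤ Λ) (hB : ∀ x y, B x y = B y x)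
    (hobt : ∀ i i', i ≠ i' → B (e i) (e i') ≤ 0) (x y : Λ)
    (hx : ∀ i, e.repr x i ≠ e.repr y i → 0 ≤ B x (e i))
    (hy : ∀ i, e.repr x i ≠ e.repr y i → 0 ≤ B y (e i)) :
    B (∑ i, min (e.repr x i) (e.repr y i) • e i) (∑ i, min (e.repr x i) (e.repr y i) • e i) ≤
      B x y := by
  -- `u` and `w` are the excesses of `x` and `y` over their minimum `θ`. Their coefficients are
  -- nonnegative with disjoint supports, so obtuseness gives `B u w ≤ 0`, and `B x y = B θ θ + B u y
  -- - B u w + B x w`.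
  set θ := ∑ i, min (e.repr x i) (e.repr y i) • e i with hθ
  set u := ∑ i, (e.repr x i - min (e.repr x i) (e.repr y i)) • e i with hu
  set w := ∑ i, (e.repr y i - min (e.repr x i) (e.repr y i)) • e i with hw
  have hxu : x = θ + u := by
    rw [hθ, hu, ← Finset.sum_add_distrib]
    conv_lhs => rw [← e.sum_repr x]
    exact Finset.sum_congr rfl fun i _ ↦ by module
  have hyw : y = θ + w := by
    rw [hθ, hw, ← Finset.sum_add_distrib]
    conv_lhs => rw [← e.sum_repr y]
    exact Finset.sum_congr rfl fun i _ ↦ by module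
  have hxw : 0 ≤ B x w := by
    rw [hw, map_sum]
    refine Finset.sum_nonneg fun i _ ↦ ?_
    rw [map_zsmul, smul_eq_mul]
    rcases eq_or_ne (e.repr x i) (e.repr y i) with h | h
    · simp [h]
    · exact mul_nonneg (by simp) (hx i h)
  have hyu : 0 ≤ B y u := by
    rw [hu, map_sum]
    refine Finset.sum_nonneg fun i _ ↦ ?_
    rw [map_zsmul, smul_eq_mul]
    rcases eq_or_ne (e.repr x i) (e.repr y i) with h | h
    · simp [h]
    · exact mul_nonneg (by simp) (hy i h)
  have huw : B u w ≤ 0 := by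
    rw [hw, map_sum]
    refine Finset.sum_nonpos fun i' _ ↦ ?_
    rw [hB, hu, map_sum]
    refine Finset.sum_nonpos fun i _ ↦ ?_
    rw [map_zsmul, map_zsmul, LinearMap.smul_apply, smul_eq_mul, smul_eq_mul, hB]
    rcases eq_or_ne i i' with rfl | h
    · rcases le_total (e.repr x i) (e.repr y i) with h | h <;> simp [h]
    · have h₁ : 0 ≤ e.repr x i - min (e.repr x i) (e.repr y i) := by simp
      have h₂ : 0 ≤ e.repr y i' - min (e.repr x i') (e.repr y i') := by simp
      rw [← mul_assoc]
      exact mul_nonpos_of_nonneg_of_nonpos (mul_nonneg h₁ h₂) (hobt i i' h)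
  have h₁ : B x y = B x θ + B x w := by rw [← map_add, ← hyw]
  have h₂ : B x θ = B θ θ + B u θ := by rw [← LinearMap.add_apply, ← map_add, ← hxu]
  have h₃ : B u y = B u θ + B u w := by rw [← map_add, ← hyw]
  rw [hB u y] at h₃
  linarith

/-! ### Levels of a root system with respect to one simple root -/

namespace RootPairing.Base

variable {ι K M N : Type*} [Field K] [CharZero K] [AddCommGroup M] [Module K M]
  [AddCommGroup N] [Module K N] {P : RootPairing ι K M N} (b : P.Base)

/-- The coefficient of a simple root in a root. -/
noncomputable def rootCoeff (j : b.support) (i : ι) : ℤ :=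
  b.toWeightBasisInt.repr (P.rootSpanMem ℤ i) j

lemma root_eq_sum_rootCoeff (i : ι) :
    P.root i = ∑ j : b.support, b.rootCoeff j i • P.root j := by
  have h := congrArg Subtype.val (b.toWeightBasisInt.sum_repr (P.rootSpanMem ℤ i))
  rw [AddSubmonoidClass.coe_finsetSum] at h
  simpa [rootCoeff] using h.symm

variable {b}

lemma rootCoeff_add {i i' k : ι} (h : P.root k = P.root i + P.root i') (j : b.support) :
    b.rootCoeff j k = b.rootCoeff j i + b.rootCoeff j i' := by
  have : P.rootSpanMem ℤ k = P.rootSpanMem ℤ i + P.rootSpanMem ℤ i' := Subtype.ext h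
  rw [rootCoeff, this, map_add]
  rfl

lemma rootCoeff_neg {i k : ι} (h : P.root k = -P.root i) (j : b.support) :
    b.rootCoeff j k = -b.rootCoeff j i := by
  have : P.rootSpanMem ℤ k = -P.rootSpanMem ℤ i := Subtype.ext h
  rw [rootCoeff, this, map_neg]
  rfl

lemma rootCoeff_sub {i i' k : ι} (h : P.root k = P.root i - P.root i') (j : b.support) :
    b.rootCoeff j k = b.rootCoeff j i - b.rootCoeff j i' := by
  have : P.rootSpanMem ℤ k = P.rootSpanMem ℤ i - P.rootSpanMem ℤ i' := Subtype.ext h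
  rw [rootCoeff, this, map_sub]
  rfl

lemma toWeightBasisInt_eq_rootSpanMem (i : b.support) :
    b.toWeightBasisInt i = P.rootSpanMem ℤ i :=
  Subtype.ext (by simp)

open Classical in
lemma rootCoeff_simple (j i : b.support) :
    b.rootCoeff j i = if i = j then 1 else 0 := by
  rw [rootCoeff, ← toWeightBasisInt_eq_rootSpanMem, Module.Basis.repr_self, Finsupp.single_apply]

@[simp] lemma rootCoeff_self (j : b.support) : b.rootCoeff j j = 1 := by
  rw [rootCoeff_simple, if_pos rfl]

lemma rootCoeff_of_ne {j i : b.support} (h : i ≠ j) : b.rootCoeff j i = 0 := by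
  rw [rootCoeff_simple, if_neg h]

lemma rootCoeff_eq_of_eq_sum {i : ι} {f : ι → ℤ}
    (h : P.root i = ∑ j ∈ b.support, f j • P.root j) (j : b.support) :
    b.rootCoeff j i = f j := by
  have : P.rootSpanMem ℤ i = ∑ j : b.support, f j • b.toWeightBasisInt j := by
    refine Subtype.ext ?_
    rw [AddSubmonoidClass.coe_finsetSum]
    change P.root i = _
    rw [h, ← Finset.sum_coe_sort b.support]
    simp
  rw [rootCoeff, this, Module.Basis.repr_sum_self]

lemma height_eq_sum_rootCoeff (i : ι) : b.height i = ∑ j : b.support, b.rootCoeff j i := by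
  obtain ⟨f, -, -, hf⟩ := b.exists_root_eq_sum_int i
  rw [height_eq_sum hf, ← Finset.sum_coe_sort b.support]
  exact Finset.sum_congr rfl fun j _ ↦ (rootCoeff_eq_of_eq_sum hf j).symm

lemma IsPos.rootCoeff_nonneg {i : ι} (h : b.IsPos i) (j : b.support) : 0 ≤ b.rootCoeff j i := by
  obtain ⟨f, -, hf | hf, hf'⟩ := b.exists_root_eq_sum_int i
  · rw [rootCoeff_eq_of_eq_sum hf']
    exact hf.le j
  · rw [isPos_iff, height_eq_sum hf'] at h
    exact absurd h (not_lt.mpr (Finset.sum_nonpos fun j _ ↦ hf.le j))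

lemma IsPos.of_rootCoeff_pos {i : ι} {j : b.support} (h : 0 < b.rootCoeff j i) : b.IsPos i := by
  let := P.indexNeg
  rcases IsPos.or_neg b i with hi | hi
  · exact hi
  · have := hi.rootCoeff_nonneg j
    rw [rootCoeff_neg (i := i) (by simp)] at this
    lia

lemma repr_nonneg_of_mem_closure {x : M}
    (hx : x ∈ AddSubmonoid.closure (P.root '' b.support)) (j : b.support) :
    ∃ hx : x ∈ P.rootSpan ℤ, 0 ≤ b.toWeightBasisInt.repr ⟨x, hx⟩ j := by
  induction hx using AddSubmonoid.closure_induction with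
  | mem x hx =>
    obtain ⟨k, hk, rfl⟩ := hx
    exact ⟨(P.rootSpanMem ℤ k).2, (isPos_of_mem_support hk).rootCoeff_nonneg j⟩
  | zero =>
    refine ⟨zero_mem _, le_of_eq ?_⟩
    change 0 = b.toWeightBasisInt.repr 0 j
    simp
  | add x y _ _ hx hy =>
    obtain ⟨hx, hx'⟩ := hx
    obtain ⟨hy, hy'⟩ := hy
    refine ⟨add_mem hx hy, ?_⟩
    change 0 ≤ b.toWeightBasisInt.repr (⟨x, hx⟩ + ⟨y, hy⟩) j
    rw [map_add, Finsupp.add_apply]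
    exact add_nonneg hx' hy'

lemma rootCoeff_nonneg_of_mem_closure {i : ι}
    (h : P.root i ∈ AddSubmonoid.closure (P.root '' b.support)) (j : b.support) :
    0 ≤ b.rootCoeff j i :=
  (repr_nonneg_of_mem_closure h j).2

lemma rootCoeff_le_of_sub_mem_closure {i i' : ι}
    (h : P.root i' - P.root i ∈ AddSubmonoid.closure (P.root '' b.support)) (j : b.support) :
    b.rootCoeff j i ≤ b.rootCoeff j i' := by
  obtain ⟨hx, hx'⟩ := repr_nonneg_of_mem_closure h j
  have : (⟨P.root i' - P.root i, hx⟩ : P.rootSpan ℤ) = P.rootSpanMem ℤ i' - P.rootSpanMem ℤ i := rfl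
  rw [this, map_sub, Finsupp.sub_apply] at hx'
  exact sub_nonneg.mp hx'

variable [Finite ι] [P.IsCrystallographic]

/-- Two roots whose coefficients at `j` have the same sign, and which are dominant with respect to
the other simple roots, form an acute angle. -/
lemma pairingIn_pos_of_dominant (j : b.support) {i i' : ι}
    (hij : 0 < b.rootCoeff j i * b.rootCoeff j i')
    (hi : ∀ k : b.support, k ≠ j → 0 ≤ P.pairingIn ℤ i k)
    (hi' : ∀ k : b.support, k ≠ j → 0 ≤ P.pairingIn ℤ i' k) :
    0 < P.pairingIn ℤ i i' := by
  have := Fintype.ofFinite ι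
  have hsub := fun i ↦ (P.rootSpanMem ℤ i).2
  set F := (P.posRootForm ℤ).posForm with hF
  have hsymm : ∀ x y, F x y = F y x := fun x y ↦ by
    exact (P.posRootForm ℤ).isSymm_posForm.eq x y
  have hdom : ∀ i : ι, (∀ k : b.support, k ≠ j → 0 ≤ P.pairingIn ℤ i k) →
      ∀ k : b.support, k ≠ j → 0 ≤ F (P.rootSpanMem ℤ i) (b.toWeightBasisInt k) := by
    intro i hi k hk
    rw [toWeightBasisInt_eq_rootSpanMem]
    by_contra! hneg
    rcases (hi k hk).lt_or_eq with h | h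
    · exact hneg.not_gt (((P.posRootForm ℤ).zero_lt_apply_root_root_iff i k).mpr h)
    · have h' := ((P.posRootForm ℤ).posForm_apply_root_root_le_zero_iff k i).mpr
        ((P.pairingIn_le_zero_iff ℤ).mp h.symm.le)
      have h'' : P.pairingIn ℤ i k = 0 := h.symm
      have h₃ := (P.posRootForm ℤ).two_mul_apply_root_root i k
      rw [← P.algebraMap_pairingIn ℤ, h'', map_zero, zero_mul] at h₃
      have h₄ : F (P.rootSpanMem ℤ i) (P.rootSpanMem ℤ k) = 0 := by
        apply FaithfulSMul.algebraMap_injective ℤ K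
        rw [hF, (P.posRootForm ℤ).algebraMap_posForm, map_zero]
        exact (mul_eq_zero.mp h₃).resolve_left two_ne_zero
      exact hneg.ne h₄
  rw [← (P.posRootForm ℤ).zero_lt_apply_root_root_iff (hi := hsub i) (hj := hsub i')]
  change 0 < F (P.rootSpanMem ℤ i) (P.rootSpanMem ℤ i')
  -- Scaling the two roots by `|q|` and `|p|` equalizes their coefficients at `j`. The index `j` is
  -- then not involved in their difference, so dominance is needed only at the other simple roots.
  set p := b.rootCoeff j i with hp
  set q := b.rootCoeff j i' with hq
  have hpq : |q| * p = |p| * q := by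
    rcases pos_and_pos_or_neg_and_neg_of_mul_pos hij with ⟨h₁, h₂⟩ | ⟨h₁, h₂⟩
    · rw [abs_of_pos h₁, abs_of_pos h₂, mul_comm]
    · rw [abs_of_neg h₁, abs_of_neg h₂]; ring
  have hp0 : p ≠ 0 := left_ne_zero_of_mul hij.ne'
  have hq0 : q ≠ 0 := right_ne_zero_of_mul hij.ne'
  have hxj : b.toWeightBasisInt.repr (|q| • P.rootSpanMem ℤ i) j = |q| * p := by
    rw [map_zsmul]; rfl
  have hyj : b.toWeightBasisInt.repr (|p| • P.rootSpanMem ℤ i') j = |p| * q := by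
    rw [map_zsmul]; rfl
  have key := b.toWeightBasisInt.form_inf_le_of_dominant F hsymm (fun k k' hk ↦ by
      rw [toWeightBasisInt_eq_rootSpanMem, toWeightBasisInt_eq_rootSpanMem]
      exact ((P.posRootForm ℤ).posForm_apply_root_root_le_zero_iff _ _).mpr
        (b.pairingIn_le_zero_of_ne (fun h ↦ hk (Subtype.ext h)) k.2 k'.2))
    (|q| • P.rootSpanMem ℤ i) (|p| • P.rootSpanMem ℤ i')
    (fun k hk ↦ by
      rw [map_zsmul, LinearMap.smul_apply]
      refine smul_nonneg (abs_nonneg _) (hdom i hi k ?_)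
      rintro rfl
      exact hk (by rw [hxj, hyj, hpq]))
    (fun k hk ↦ by
      rw [map_zsmul, LinearMap.smul_apply]
      refine smul_nonneg (abs_nonneg _) (hdom i' hi' k ?_)
      rintro rfl
      exact hk (by rw [hxj, hyj, hpq]))
  have hθ : 0 < |q| * |p| * F (P.rootSpanMem ℤ i) (P.rootSpanMem ℤ i') := by
    -- The minimum of the two scaled roots is nonzero, since its coefficient at `j` is the common
    -- value `|q| * p ≠ 0`.
    refine (lt_of_lt_of_le (P.posRootForm_posForm_pos_of_ne_zero ℤ fun h0 ↦ ?_) key).trans_eq ?_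
    · have := congrArg (fun x ↦ b.toWeightBasisInt.repr x j) h0
      simp only [Module.Basis.repr_sum_self, hxj, hyj, hpq, min_self, map_zero,
        Finsupp.coe_zero, Pi.zero_apply] at this
      simp [hp0, hq0] at this
    · rw [map_zsmul, map_zsmul, LinearMap.smul_apply, smul_eq_mul, smul_eq_mul]
      ring
  exact pos_of_mul_pos_right hθ (by positivity)

/-- A set of roots with nonzero coefficient at `j` that is closed under the addition of simple
roots other than the one at `j` has a member that is dominant with respect to those. -/
lemma exists_dominant_of_closed (j : b.support) (X : Set ι) (hX : X.Nonempty)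
    (hj : ∀ i ∈ X, b.rootCoeff j i ≠ 0)
    (hcl : ∀ i ∈ X, ∀ k : b.support, k ≠ j → ∀ i', P.root i' = P.root i + P.root k → i' ∈ X) :
    ∃ i ∈ X, ∀ k : b.support, k ≠ j → 0 ≤ P.pairingIn ℤ i k := by
  -- A member of maximal height works: if it paired negatively with a simple root, their sum would
  -- be a higher member.
  obtain ⟨i, hi, hmax⟩ := Set.exists_max_image X b.height X.toFinite hX
  refine ⟨i, hi, fun k hk ↦ ?_⟩
  by_contra! hneg
  obtain ⟨i', hi'⟩ := P.root_add_root_mem_of_pairingIn_neg hneg fun h ↦ hj i hi (by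
    rw [rootCoeff_neg h, rootCoeff_of_ne hk, neg_zero])
  have h₁ := hmax i' (hcl i hi k hk i' hi')
  rw [b.height_add hi', height_one_of_mem_support k.2] at h₁
  lia

/-- The roots with a given nonzero coefficient at `j` are connected under the addition of roots
with coefficient zero at `j`. -/
lemma mem_of_rootCoeff_eq (j : b.support) (X : Set ι)
    (hcl : ∀ i ∈ X, ∀ k, b.rootCoeff j k = 0 → ∀ i', P.root i' = P.root i + P.root k → i' ∈ X)
    {i i' : ι} (hi : i ∈ X) (hj : b.rootCoeff j i ≠ 0)
    (hii' : b.rootCoeff j i' = b.rootCoeff j i) : i' ∈ X := by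
  let := P.indexNeg
  by_contra hi'
  set p := b.rootCoeff j i with hp
  obtain ⟨γ, ⟨hγX, hγ⟩, hγd⟩ := b.exists_dominant_of_closed j {l | l ∈ X ∧ b.rootCoeff j l = p}
    ⟨i, hi, rfl⟩ (fun l hl ↦ hl.2 ▸ hj) fun l hl k hk l' hl' ↦
      ⟨hcl l hl.1 k (rootCoeff_of_ne hk) l' hl', by
        rw [rootCoeff_add hl', rootCoeff_of_ne hk, add_zero, hl.2]⟩
  -- The complement of `X` in the level is closed as well: if `l + α_k` were in `X`, adding `-α_k`,
  -- which also has coefficient zero at `j`, would put `l` into `X`.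
  obtain ⟨δ, ⟨hδX, hδ⟩, hδd⟩ := b.exists_dominant_of_closed j {l | l ∉ X ∧ b.rootCoeff j l = p}
    ⟨i', hi', hii'⟩ (fun l hl ↦ hl.2 ▸ hj) fun l hl k hk l' hl' ↦
      ⟨fun hl'X ↦ hl.1 (hcl l' hl'X (-k.1) (by
        rw [rootCoeff_neg (i := k.1) (by simp), rootCoeff_of_ne hk, neg_zero]) l (by
        rw [hl']; simp)), by
        rw [rootCoeff_add hl', rootCoeff_of_ne hk, add_zero, hl.2]⟩
  have hpos := b.pairingIn_pos_of_dominant j (i := δ) (i' := γ)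
    (by rw [hγ, hδ]; exact mul_self_pos.mpr hj) hδd hγd
  obtain ⟨k, hk⟩ := P.root_sub_root_mem_of_pairingIn_pos hpos fun h ↦ hδX (h ▸ hγX)
  exact hδX (hcl γ hγX k (by rw [rootCoeff_sub hk, hγ, hδ, sub_self]) δ (by rw [hk]; abel))

/-- If distinct `p` and `r` of the same sign occur as coefficients at `j` of roots, then they occur
as coefficients of two roots whose difference is a root. -/
lemma exists_root_sub_root (j : b.support) {i i' : ι}
    (hij : 0 < b.rootCoeff j i * b.rootCoeff j i') (hne : b.rootCoeff j i ≠ b.rootCoeff j i') :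
    ∃ γ δ k, b.rootCoeff j γ = b.rootCoeff j i ∧ b.rootCoeff j δ = b.rootCoeff j i' ∧
      P.root k = P.root γ - P.root δ := by
  have aux : ∀ i, b.rootCoeff j i ≠ 0 → ∃ γ, b.rootCoeff j γ = b.rootCoeff j i ∧
      ∀ k : b.support, k ≠ j → 0 ≤ P.pairingIn ℤ γ k := fun i hi ↦
    b.exists_dominant_of_closed j {l | b.rootCoeff j l = b.rootCoeff j i} ⟨i, rfl⟩
      (fun l hl ↦ by rw [show b.rootCoeff j l = _ from hl]; exact hi) fun l hl k hk l' hl' ↦ by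
        change b.rootCoeff j l' = _
        rw [rootCoeff_add hl', rootCoeff_of_ne hk, add_zero]
        exact hl
  obtain ⟨γ, hγ, hγd⟩ := aux i (left_ne_zero_of_mul hij.ne')
  obtain ⟨δ, hδ, hδd⟩ := aux i' (right_ne_zero_of_mul hij.ne')
  obtain ⟨k, hk⟩ := P.root_sub_root_mem_of_pairingIn_pos
    (b.pairingIn_pos_of_dominant j (by rwa [hγ, hδ]) hγd hδd) fun h ↦ hne (by rw [← hγ, ← hδ, h])
  exact ⟨γ, δ, k, hγ, hδ, hk⟩

/-- The positive coefficients at `j` of roots form an interval. -/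
lemma exists_rootCoeff_eq_of_le (j : b.support) {i : ι} {p : ℤ} (hp : 0 < p)
    (hpi : p ≤ b.rootCoeff j i) : ∃ i', b.rootCoeff j i' = p := by
  have hi : b.IsPos i := IsPos.of_rootCoeff_pos (hp.trans_le hpi)
  revert hpi
  -- Adding a simple root changes the coefficient at `j` by 0 or 1, so no value is skipped on the
  -- way up.
  refine hi.induction_on_add (p := fun i ↦ p ≤ b.rootCoeff j i → ∃ i', b.rootCoeff j i' = p)
    (fun k hk hpk ↦ ?_) (fun l k l' hl' ih hk hpl' ↦ ?_)
  · rcases eq_or_ne ⟨k, hk⟩ j with rfl | h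
    · rw [rootCoeff_self ⟨k, hk⟩] at hpk
      exact ⟨k, by rw [rootCoeff_self ⟨k, hk⟩]; lia⟩
    · rw [rootCoeff_of_ne (i := ⟨k, hk⟩) h] at hpk
      lia
  · by_cases hpl : p ≤ b.rootCoeff j l
    · exact ih hpl
    · refine ⟨l', ?_⟩
      rw [rootCoeff_add hl'] at hpl' ⊢
      rcases eq_or_ne ⟨k, hk⟩ j with rfl | h
      · rw [rootCoeff_self ⟨k, hk⟩] at hpl' ⊢
        lia
      · rw [rootCoeff_of_ne (i := ⟨k, hk⟩) h] at hpl' ⊢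
        lia

end RootPairing.Base

/-! ### The maximal root -/

namespace RootPairing.Base

variable {ι K M N : Type*} [Field K] [CharZero K] [AddCommGroup M] [Module K M]
  [AddCommGroup N] [Module K N] {P : RootPairing ι K M N} (b : P.Base)

/-- A root is maximal if no other root is obtained from it by adding simple roots. -/
def IsMaximalRoot (ψ : ι) : Prop :=
  ∀ φ, P.root φ - P.root ψ ∈ AddSubmonoid.closure (P.root '' b.support) → φ = ψ

variable {b}

/-- If `-ψ` is a sum of simple roots, then so is `-ψ - ψ`. Maximality gives `-ψ = ψ`, and all
coefficients vanish. -/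
lemma IsMaximalRoot.rootCoeff_nonneg {ψ : ι} (hψ : b.IsMaximalRoot ψ) (j : b.support) :
    0 ≤ b.rootCoeff j ψ := by
  rcases b.root_mem_or_neg_mem ψ with h | h
  · exact rootCoeff_nonneg_of_mem_closure h j
  · let := P.indexNeg
    have h₁ : -ψ = ψ := hψ (-ψ) (by
      rw [show P.root (-ψ) = -P.root ψ by simp, sub_eq_add_neg]
      exact add_mem h h)
    have h₂ := rootCoeff_neg (b := b) (i := ψ) (k := -ψ) (by simp) j
    rw [h₁] at h₂
    lia

lemma pairingIn_eq_sum_rootCoeff [P.IsCrystallographic] (i i' : ι) :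
    P.pairingIn ℤ i i' = ∑ j : b.support, b.rootCoeff j i * P.pairingIn ℤ j i' := by
  apply FaithfulSMul.algebraMap_injective ℤ K
  simp_rw [algebraMap_pairingIn, map_sum, map_mul, algebraMap_pairingIn, ← root_coroot_eq_pairing]
  conv_lhs => rw [b.root_eq_sum_rootCoeff i]
  simp

variable [Finite ι] [P.IsCrystallographic]

/-- A negative pairing would make `ψ + α_k` a root, against maximality; the exception `ψ = -α_k` has
a negative coefficient. -/
lemma IsMaximalRoot.pairingIn_nonneg {ψ : ι} (hψ : b.IsMaximalRoot ψ) (k : b.support) :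
    0 ≤ P.pairingIn ℤ ψ k := by
  by_contra! hneg
  by_cases h : P.root ψ = -P.root k
  · have := hψ.rootCoeff_nonneg k
    rw [rootCoeff_neg h, rootCoeff_self] at this
    lia
  · obtain ⟨φ, hφ⟩ := P.root_add_root_mem_of_pairingIn_neg hneg h
    have hφψ : φ = ψ := hψ φ (by
      rw [hφ, add_sub_cancel_left]
      exact AddSubmonoid.subset_closure ⟨k, k.2, rfl⟩)
    rw [hφψ, left_eq_add] at hφ
    exact P.ne_zero k.1 hφ

/-- If `n` is the coefficient at `j` of a root, then every nonzero integer between `-n` and `n` is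
one, too. -/
lemma exists_rootCoeff_eq (j : b.support) {ψ : ι} {p : ℤ}
    (hp0 : p ≠ 0) (hp : |p| ≤ b.rootCoeff j ψ) : ∃ φ, b.rootCoeff j φ = p := by
  let := P.indexNeg
  obtain ⟨φ, hφ⟩ := b.exists_rootCoeff_eq_of_le j (abs_pos.mpr hp0) hp
  rcases abs_choice p with h | h
  · exact ⟨φ, by rw [hφ, h]⟩
  · exact ⟨-φ, by rw [rootCoeff_neg (i := φ) (by simp), hφ, h, neg_neg]⟩

variable [P.IsReduced] [P.IsRootSystem] [P.IsIrreducible]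

/-- Let `S` be the set of simple roots involved in `ψ`. Dominance of `ψ` makes every simple root
outside `S` orthogonal to `S`, so the span of `S` is stable under all reflections. By irreducibility
it is the whole space, and therefore `S` contains every simple root. -/
lemma IsMaximalRoot.rootCoeff_pos {ψ : ι} (hψ : b.IsMaximalRoot ψ) (j : b.support) :
    0 < b.rootCoeff j ψ := by
  refine (hψ.rootCoeff_nonneg j).lt_of_ne' fun hj ↦ ?_
  set S : Set ι := {i | ∃ h : i ∈ b.support, b.rootCoeff ⟨i, h⟩ ψ ≠ 0} with hS
  have horth : ∀ i ∈ S, ∀ k : b.support, k.1 ∉ S → P.pairing i k = 0 := by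
    rintro i ⟨hi, hi0⟩ k hk
    have hk0 : b.rootCoeff k ψ = 0 := by
      by_contra h
      exact hk ⟨k.2, h⟩
    have hsum := hψ.pairingIn_nonneg k
    rw [b.pairingIn_eq_sum_rootCoeff] at hsum
    have hterm : ∀ l ∈ Finset.univ, b.rootCoeff l ψ * P.pairingIn ℤ l k ≤ 0 := by
      intro l _
      rcases eq_or_ne l k with rfl | hlk
      · rw [hk0, zero_mul]
      · exact mul_nonpos_of_nonneg_of_nonpos (hψ.rootCoeff_nonneg l)
          (b.pairingIn_le_zero_of_ne (fun h ↦ hlk (Subtype.ext h)) l.2 k.2)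
    have h0 := (Finset.sum_eq_zero_iff_of_nonpos hterm).mp
      (le_antisymm (Finset.sum_nonpos hterm) hsum) ⟨i, hi⟩ (Finset.mem_univ _)
    rw [← P.algebraMap_pairingIn ℤ, (mul_eq_zero.mp h0).resolve_left hi0, map_zero]
  have hinv : ∀ i ∈ b.support,
      Submodule.span K (P.root '' S) ∈ Module.End.invtSubmodule (P.reflection i) := by
    intro i hi
    by_cases hiS : i ∈ S
    · exact Submodule.mem_invtSubmodule_reflection_of_mem _ _
        (Submodule.subset_span ⟨i, hiS, rfl⟩)
    · rw [Module.End.mem_invtSubmodule, Submodule.span_le]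
      rintro _ ⟨k, hk, rfl⟩
      have : P.reflection i (P.root k) = P.root k := by
        rw [reflection_apply_root, horth k hk ⟨i, hi⟩ hiS, zero_smul, sub_zero]
      change P.reflection i (P.root k) ∈ Submodule.span K (P.root '' S)
      rw [this]
      exact Submodule.subset_span ⟨k, hk, rfl⟩
  have htop := IsIrreducible.eq_top_of_invtSubmodule_reflection (P := P) _
    ((b.forall_mem_support_invtSubmodule_iff _).mp hinv) fun hbot ↦ by
      refine P.ne_zero ψ ?_
      rw [b.root_eq_sum_rootCoeff ψ]
      refine Finset.sum_eq_zero fun l _ ↦ ?_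
      by_cases hl : b.rootCoeff l ψ = 0
      · rw [hl, zero_smul]
      · exact absurd ((Submodule.span_eq_bot.mp hbot) _ ⟨l, ⟨l.2, hl⟩, rfl⟩) (P.ne_zero _)
  have hle : Submodule.span K (P.root '' S) ≤ LinearMap.ker (b.toWeightBasis.coord j) := by
    rw [Submodule.span_le]
    rintro _ ⟨k, ⟨hk, hk0⟩, rfl⟩
    have : (⟨k, hk⟩ : b.support) ≠ j := by
      rintro rfl
      exact hk0 hj
    simpa [Finsupp.single_apply] using b.toWeightBasis_repr_root ⟨k, hk⟩ ▸
      Finsupp.single_eq_of_ne this.symm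
  have : b.toWeightBasis.coord j (P.root j) = 0 := hle (htop ▸ Submodule.mem_top)
  simp at this

/-- An irreducible root system has only one maximal root. -/
lemma IsMaximalRoot.unique {ψ φ : ι} (hψ : b.IsMaximalRoot ψ) (hφ : b.IsMaximalRoot φ) :
    φ = ψ := by
  obtain ⟨j⟩ : Nonempty b.support := by
    have : Nonempty ι := ⟨ψ⟩
    exact b.support_nonempty.to_subtype
  -- Two maximal roots pair positively, so if distinct their difference is a root. It or its
  -- negative is a sum of simple roots, which contradicts the maximality of one of them.
  have hpos := b.pairingIn_pos_of_dominant j (mul_pos (hφ.rootCoeff_pos j) (hψ.rootCoeff_pos j))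
    (fun k _ ↦ hφ.pairingIn_nonneg k) (fun k _ ↦ hψ.pairingIn_nonneg k)
  by_contra hne
  obtain ⟨k, hk⟩ := P.root_sub_root_mem_of_pairingIn_pos hpos hne
  rcases b.root_mem_or_neg_mem k with h | h
  · exact hne (hψ φ (hk ▸ h))
  · exact hne (hφ ψ (by rwa [hk, neg_sub] at h)).symm

/-- The maximal root of an irreducible root system has the largest coefficients. -/
lemma IsMaximalRoot.rootCoeff_le {ψ : ι} (hψ : b.IsMaximalRoot ψ) (φ : ι) (j : b.support) :
    b.rootCoeff j φ ≤ b.rootCoeff j ψ := by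
  -- A root of maximal height among those above `φ` is a maximal root, hence equal to `ψ` by
  -- uniqueness.
  obtain ⟨χ, hχ, hmax⟩ := Set.exists_max_image
    {χ | P.root χ - P.root φ ∈ AddSubmonoid.closure (P.root '' b.support)} b.height
    (Set.toFinite _) ⟨φ, by simp⟩
  have hχm : b.IsMaximalRoot χ := by
    intro ω hω
    by_contra hne
    have h₁ : P.root ω - P.root φ ∈ AddSubmonoid.closure (P.root '' b.support) := by
      simpa using add_mem hω hχ
    have h₂ := hmax ω h₁
    rw [height_eq_sum_rootCoeff, height_eq_sum_rootCoeff] at h₂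
    have h₃ : ∀ l ∈ Finset.univ, b.rootCoeff l χ ≤ b.rootCoeff l ω := fun l _ ↦
      rootCoeff_le_of_sub_mem_closure hω l
    have h₄ := (Finset.sum_eq_sum_iff_of_le h₃).mp (le_antisymm (Finset.sum_le_sum h₃) h₂)
    refine hne (P.root.injective ?_)
    rw [b.root_eq_sum_rootCoeff ω, b.root_eq_sum_rootCoeff χ]
    exact Finset.sum_congr rfl fun l hl ↦ by rw [h₄ l hl]
  rw [← hψ.unique hχm]
  exact rootCoeff_le_of_sub_mem_closure hχ j

lemma IsMaximalRoot.abs_rootCoeff_le {ψ : ι} (hψ : b.IsMaximalRoot ψ) (φ : ι) (j : b.support) :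
    |b.rootCoeff j φ| ≤ b.rootCoeff j ψ := by
  let := P.indexNeg
  have h := hψ.rootCoeff_le (-φ) j
  rw [rootCoeff_neg (i := φ) (by simp)] at h
  exact abs_le.mpr ⟨by lia, hψ.rootCoeff_le φ j⟩

end RootPairing.Base

/-! ### Root vectors and root spaces -/

/-- The bracket of nonzero root vectors for roots `α` and `β` is nonzero if `α + β` is a root. -/
lemma LieAlgebra.IsKilling.lie_ne_zero_of_mem_rootSpace {K L : Type*} [Field K] [CharZero K]
    [LieRing L] [LieAlgebra K L] [IsKilling K L] [FiniteDimensional K L]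
    {H : LieSubalgebra K L} [H.IsCartanSubalgebra] [LieModule.IsTriangularizable K H L]
    {α β : LieModule.Weight K H L} (hα : α.IsNonZero) (hβ : β.IsNonZero)
    (hαβ : rootSpace H (α + β : H → K) ≠ ⊥) {x y : L} (hx : x ∈ rootSpace H α)
    (hy : y ∈ rootSpace H β) (hx0 : x ≠ 0) (hy0 : y ≠ 0) : ⁅x, y⁆ ≠ 0 := by
  obtain ⟨h, e, f, t, he, hf⟩ := exists_isSl2Triple_of_weight_isNonZero hα
  obtain rfl := t.h_eq_coroot hα he hf
  -- `v` spans the top of the `α`-string through `β`. With `n` the length of the string, `e f^(r+1)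
  -- v = (r+1)(n-r) f^r v`, which is nonzero for `r < n`. Root spaces being lines, `e` and `f^(r+1)
  -- v` are multiples of `x` and `y` when `r + 1` is the distance from `β` to the top; this distance
  -- is positive because `α + β` occurs.
  obtain ⟨v, hv, hv0⟩ := (LieModule.chainTop α β).exists_ne_zero
  have P : t.HasPrimitiveVectorWith v (chainLength α β : K) :=
    have := LieAlgebra.lie_mem_genWeightSpace_of_mem_genWeightSpace he hv
    ⟨hv0, (chainLength_smul _ _ hv).symm, by
      rwa [LieModule.genWeightSpace_add_chainTop _ _ hα] at this⟩
  have hr : 1 ≤ LieModule.chainTopCoeff α β := by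
    have := ((rootSpace_zsmul_add_ne_bot_iff α β hα 1).mp (by rwa [one_smul])).1
    exact_mod_cast this
  obtain ⟨r, hr⟩ : ∃ r, LieModule.chainTopCoeff α β = r + 1 := ⟨_, (Nat.sub_add_cancel hr).symm⟩
  have hrn : r + 1 ≤ chainLength α β := hr ▸ chainTopCoeff_le_chainLength α β
  have hw : ((LieModule.toEnd K L L f) ^ (r + 1)) v ∈ rootSpace H β := by
    have := LieAlgebra.toEnd_pow_apply_mem hf hv (r + 1)
    rwa [LieModule.coe_chainTop, hr, smul_neg, natCast_zsmul,
      neg_add_cancel_left] at this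
  have aux : ∀ {γ : LieModule.Weight K H L} (hγ : γ.IsNonZero) {g z : L}, g ∈ rootSpace H γ →
      g ≠ 0 → z ∈ rootSpace H γ → ∃ c : K, c • g = z := by
    intro γ hγ g z hg hg0 hz
    obtain ⟨c, hc⟩ := (finrank_eq_one_iff_of_nonzero' ⟨g, hg⟩
      (by rwa [ne_eq, LieSubmodule.mk_eq_zero])).mp (finrank_rootSpace_eq_one γ hγ) ⟨z, hz⟩
    exact ⟨c, by simpa using hc⟩
  obtain ⟨c, rfl⟩ := aux hα hx hx0 he
  obtain ⟨d, hd⟩ := aux hβ hy hy0 hw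
  intro hxy
  have h₁ := P.lie_e_pow_succ_toEnd_f r
  rw [← hd, smul_lie, lie_smul, hxy, smul_zero, smul_zero] at h₁
  refine smul_ne_zero (mul_ne_zero (Nat.cast_add_one_ne_zero r) ?_)
    (P.pow_toEnd_f_ne_zero_of_eq_nat rfl (by lia : r ≤ chainLength α β)) h₁.symm
  rw [sub_ne_zero]
  exact_mod_cast (by lia : chainLength α β ≠ r)

/-- A Lie submodule over a Cartan subalgebra which meets a root space contains it. -/
lemma LieAlgebra.IsKilling.rootSpace_le_of_mem {K L : Type*} [Field K] [CharZero K]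
    [LieRing L] [LieAlgebra K L] [IsKilling K L] [FiniteDimensional K L]
    {H : LieSubalgebra K L} [H.IsCartanSubalgebra] [LieModule.IsTriangularizable K H L]
    {α : LieModule.Weight K H L} (hα : α.IsNonZero) (N : LieSubmodule K H L) {x : L}
    (hxN : x ∈ N) (hx : x ∈ rootSpace H α) (hx0 : x ≠ 0) : rootSpace H α ≤ N := by
  intro z hz
  obtain ⟨c, hc⟩ := (finrank_eq_one_iff_of_nonzero' ⟨x, hx⟩
    (by rwa [ne_eq, LieSubmodule.mk_eq_zero])).mp (finrank_rootSpace_eq_one α hα) ⟨z, hz⟩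
  have : c • x = z := by simpa using hc
  exact this ▸ N.smul_mem c hxN

/-- The zero root space of a Cartan subalgebra is that subalgebra. -/
lemma LieModule.Weight.IsZero.mem_of_mem_rootSpace {K L : Type*} [Field K]
    [LieRing L] [LieAlgebra K L] [FiniteDimensional K L]
    {H : LieSubalgebra K L} [H.IsCartanSubalgebra]
    {χ : LieModule.Weight K H L} (hχ : χ.IsZero) {z : L} (hz : z ∈ rootSpace H χ) : z ∈ H := by
  have h : (χ : H → K) = 0 := hχ
  rw [h, rootSpace_zero_eq K L H] at hz
  exact hz

/-! ### The centre of the Levi factor and the spaces `g_{kβ}` -/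

namespace TRoots

variable {L : Type*} [LieRing L] [LieAlgebra ℂ L] [FiniteDimensional ℂ L]
  [LieAlgebra.IsSimple ℂ L] {H : LieSubalgebra ℂ L} [H.IsCartanSubalgebra]
  {b : (rootSystem H).Base}

lemma root_apply_dualElt (φ : H.root) (j : b.support) :
    (φ : LieModule.Weight ℂ H L) (dualElt b j) = (coeff b φ j : ℂ) := by
  classical
  -- `coeff` unfolds to `rootCoeff`, just as `IsHighestRoot` unfolds to `IsMaximalRoot`; this
  -- carries the results on abstract root systems over to `L`.
  change (rootSystem H).root φ (dualElt b j) = (b.rootCoeff j φ : ℂ)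
  rw [b.root_eq_sum_rootCoeff φ, LinearMap.sum_apply, Finset.sum_eq_single j]
  · rw [LinearMap.smul_apply, root_dualElt, if_pos rfl, zsmul_eq_mul, mul_one]
  · intro i _ hi
    rw [LinearMap.smul_apply, root_dualElt, if_neg hi, smul_zero]
  · simp

lemma lie_dualElt_of_mem_rootSpace {φ : H.root} {z : L} (hz : z ∈ rootSpace H φ.1)
    (j : b.support) : ⁅(dualElt b j : L), z⁆ = (coeff b φ j : ℂ) • z := by
  have := lie_eq_smul_of_mem_rootSpace hz (dualElt b j)
  rwa [root_apply_dualElt] at this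

lemma lie_dualElt_of_mem_cartan {z : L} (hz : z ∈ H) (j : b.support) :
    ⁅(dualElt b j : L), z⁆ = 0 :=
  cartan_le_levi b j hz

lemma mem_levi {j : b.support} {z : L} : z ∈ levi b j ↔ ⁅(dualElt b j : L), z⁆ = 0 := Iff.rfl

lemma rootSpace_le_levi {φ : H.root} {j : b.support} (hφ : coeff b φ j = 0) {z : L}
    (hz : z ∈ rootSpace H φ.1) : z ∈ levi b j := by
  rw [mem_levi, lie_dualElt_of_mem_rootSpace hz, hφ, Int.cast_zero, zero_smul]

/-- The element `x_j`, as a member of the center of the Levi factor. -/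
noncomputable def centerElt (b : (rootSystem H).Base) (j : b.support) : center ℂ (levi b j) :=
  ⟨⟨dualElt b j, lie_dualElt_of_mem_cartan (dualElt b j).2 j⟩, fun z ↦ Subtype.ext (by
    have h : ⁅(dualElt b j : L), (z : L)⁆ = 0 := z.2
    change ⁅(z : L), (dualElt b j : L)⁆ = 0
    rw [← lie_skew, h, neg_zero])⟩

@[simp] lemma coe_centerElt (j : b.support) :
    ((centerElt b j : levi b j) : L) = dualElt b j := rfl

lemma centerToCartan_centerElt (j : b.support) :
    centerToCartan b j (centerElt b j) = dualElt b j := rfl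

lemma beta_centerElt (j : b.support) : beta b j (centerElt b j) = 1 := by
  rw [beta, LinearMap.comp_apply, centerToCartan_centerElt, root_dualElt, if_pos rfl]

/-- The center of the Levi factor is spanned by `x_j`. -/
lemma eq_beta_smul_centerElt (j : b.support) (x : center ℂ (levi b j)) :
    x = beta b j x • centerElt b j := by
  classical
  refine Subtype.ext (Subtype.ext ?_)
  change ((centerToCartan b j x : H) : L) = ((beta b j x • dualElt b j : H) : L)
  congr 1
  rw [← sub_eq_zero, ← Module.forall_dual_apply_eq_zero_iff ℂ]
  suffices h : ∀ i : b.support,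
      (rootSystem H).root i (centerToCartan b j x - beta b j x • dualElt b j) = 0 by
    intro f
    rw [← b.toWeightBasis.sum_repr f, LinearMap.sum_apply]
    refine Finset.sum_eq_zero fun i _ ↦ ?_
    rw [LinearMap.smul_apply, RootPairing.Base.toWeightBasis_apply, h i, smul_zero]
  intro i
  rw [map_sub, map_smul, root_dualElt]
  split_ifs with hij
  · subst hij
    simp [beta]
  · rw [smul_zero, sub_zero]
    -- For `i ≠ j` a root vector of `α_i` lies in the Levi factor, so it commutes with `x`; hence
    -- `α_i(x) = 0`.
    obtain ⟨e, he, he0⟩ := i.1.1.exists_ne_zero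
    have hel : e ∈ levi b j := rootSpace_le_levi (φ := i.1)
      (RootPairing.Base.rootCoeff_of_ne hij) he
    have h₁ : ⁅(⟨e, hel⟩ : levi b j), (x : levi b j)⁆ = 0 := x.2 _
    have h₂ : ⁅e, ((x : levi b j) : L)⁆ = 0 := congrArg Subtype.val h₁
    have h₃ := lie_eq_smul_of_mem_rootSpace he (centerToCartan b j x)
    change ⁅((x : levi b j) : L), e⁆ = _ at h₃
    rw [← lie_skew, h₂, neg_zero] at h₃
    exact (smul_eq_zero.mp h₃.symm).resolve_right he0

lemma dual_eq_smul_beta (j : b.support) (μ : Module.Dual ℂ (center ℂ (levi b j))) :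
    μ = μ (centerElt b j) • beta b j := by
  ext x
  conv_lhs => rw [eq_beta_smul_centerElt j x]
  rw [map_smul, LinearMap.smul_apply, smul_eq_mul, smul_eq_mul, mul_comm]

/-- The centre is a line, so the weight condition need only be tested on its generator `x_j`. -/
lemma mem_weightSpace_levi {j : b.support} {μ : Module.Dual ℂ (center ℂ (levi b j))} {z : L} :
    z ∈ weightSpace (levi b j) μ ↔ ⁅(dualElt b j : L), z⁆ = μ (centerElt b j) • z := by
  refine ⟨fun h ↦ h (centerElt b j), fun h x ↦ ?_⟩
  rw [eq_beta_smul_centerElt j x, map_smul, smul_assoc, ← h, ← smul_lie]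
  rfl

lemma zsmul_beta_centerElt (j : b.support) (k : ℤ) : (k • beta b j) (centerElt b j) = (k : ℂ) := by
  rw [LinearMap.smul_apply, beta_centerElt, zsmul_eq_mul, mul_one]

lemma zsmul_beta_injective (j : b.support) : Function.Injective (fun k : ℤ ↦ k • beta b j) := by
  intro k l h
  have := congrArg (fun f ↦ f (centerElt b j)) h
  simp only [zsmul_beta_centerElt] at this
  exact_mod_cast this

lemma mem_betaSpace {j : b.support} {k : ℤ} {z : L} :
    z ∈ betaSpace b j k ↔ ⁅(dualElt b j : L), z⁆ = (k : ℂ) • z := by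
  rw [betaSpace, mem_weightSpace_levi, zsmul_beta_centerElt]

lemma rootSpace_le_betaSpace (φ : H.root) (j : b.support) {z : L} (hz : z ∈ rootSpace H φ.1) :
    z ∈ betaSpace b j (coeff b φ j) :=
  mem_betaSpace.mpr (lie_dualElt_of_mem_rootSpace hz j)

/-- A subspace stable under the Levi factor is stable under the Cartan subalgebra. -/
def restrictCartan {j : b.support} (N : LieSubmodule ℂ (levi b j) L) : LieSubmodule ℂ H L where
  __ := (N : Submodule ℂ L)
  lie_mem {x _} hz := N.lie_mem (x := ⟨x, cartan_le_levi b j x.2⟩) hz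

lemma isNonZero_of_lie_dualElt {χ : LieModule.Weight ℂ H L} {j : b.support} {z : L} {c : ℂ}
    (hz : z ∈ rootSpace H χ) (hz0 : z ≠ 0) (hc : c ≠ 0)
    (hzc : ⁅(dualElt b j : L), z⁆ = c • z) : χ.IsNonZero := by
  intro h
  rw [lie_dualElt_of_mem_cartan (h.mem_of_mem_rootSpace hz)] at hzc
  exact smul_ne_zero hc hz0 hzc.symm

/-- A nonzero subspace that is stable under the Levi factor, and on which `x_j` acts as a nonzero
scalar, contains a root space. -/
lemma exists_rootSpace_le {j : b.support} {N : LieSubmodule ℂ (levi b j) L} (hN : N ≠ ⊥) {c : ℂ}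
    (hc : c ≠ 0) (hNc : ∀ z ∈ N, ⁅(dualElt b j : L), z⁆ = c • z) :
    ∃ φ : H.root, (coeff b φ j : ℂ) = c ∧ rootSpace H φ.1 ≤ restrictCartan N := by
  have hN' : restrictCartan N ≠ ⊥ := fun h ↦ hN (by
    rw [LieSubmodule.eq_bot_iff] at h ⊢
    exact h)
  -- An `H`-stable subspace is the sum of its intersections with the weight spaces, so some
  -- intersection is nonzero. Its weight is nonzero because `x_j` acts as `c ≠ 0`, and the root
  -- space, being a line, is contained in `N`.
  rw [LieModule.eq_iSup_inf_genWeightSpace ℂ H L (restrictCartan N), ne_eq, iSup_eq_bot] at hN'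
  push Not at hN'
  obtain ⟨χ, hχ⟩ := hN'
  rw [ne_eq, LieSubmodule.eq_bot_iff] at hχ
  push Not at hχ
  obtain ⟨z, ⟨hzN, hz⟩, hz0⟩ := hχ
  have hzc := hNc z hzN
  have hχ0 := isNonZero_of_lie_dualElt hz hz0 hc hzc
  refine ⟨⟨χ, by simpa using hχ0⟩, ?_, rootSpace_le_of_mem hχ0 _ hzN hz hz0⟩
  have h := lie_dualElt_of_mem_rootSpace (φ := ⟨χ, by simpa using hχ0⟩) hz j
  rw [hzc] at h
  exact (smul_left_injective ℂ hz0 h).symm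

/-- The space `g_{kβ}` is the sum of the root spaces it contains if `k ≠ 0`. -/
lemma betaSpace_le {j : b.support} {k : ℤ} (hk : k ≠ 0) (N : LieSubmodule ℂ H L)
    (hN : ∀ φ : H.root, coeff b φ j = k → rootSpace H φ.1 ≤ N) {z : L}
    (hz : z ∈ betaSpace b j k) : z ∈ N := by
  suffices restrictCartan (betaSpace b j k) ≤ N from this hz
  rw [LieModule.eq_iSup_inf_genWeightSpace ℂ H L (restrictCartan (betaSpace b j k))]
  refine iSup_le fun χ ↦ ?_
  rintro z ⟨hzN, hz⟩
  rcases eq_or_ne z 0 with rfl | hz0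
  · exact zero_mem _
  have hzc := mem_betaSpace.mp hzN
  have hχ0 := isNonZero_of_lie_dualElt hz hz0 (Int.cast_ne_zero.mpr hk) hzc
  refine hN ⟨χ, by simpa using hχ0⟩ ?_ hz
  have h := lie_dualElt_of_mem_rootSpace (φ := ⟨χ, by simpa using hχ0⟩) hz j
  rw [hzc] at h
  exact (Int.cast_injective (smul_left_injective ℂ hz0 h)).symm

lemma betaSpace_ne_bot (φ : H.root) (j : b.support) : betaSpace b j (coeff b φ j) ≠ ⊥ := by
  obtain ⟨e, he, he0⟩ := φ.1.exists_ne_zero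
  intro h
  exact he0 (by simpa using (h ▸ rootSpace_le_betaSpace φ j he : e ∈ (⊥ : LieSubmodule ℂ _ L)))

/-- The root space of `φ + η` is generated by that of `φ` if `η` is a root. -/
lemma exists_lie_ne_zero {φ η χ : H.root}
    (h : (rootSystem H).root χ = (rootSystem H).root φ + (rootSystem H).root η) :
    ∃ x ∈ rootSpace H η.1, ∃ y ∈ rootSpace H φ.1, ⁅x, y⁆ ∈ rootSpace H χ.1 ∧ ⁅x, y⁆ ≠ 0 := by
  obtain ⟨x, hx, hx0⟩ := η.1.exists_ne_zero
  obtain ⟨y, hy, hy0⟩ := φ.1.exists_ne_zero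
  have hχ : (χ.1 : H → ℂ) = η.1 + φ.1 := by
    ext t
    have := congrArg (fun f ↦ f t) h
    simpa [add_comm] using this
  refine ⟨x, hx, y, hy, ?_, lie_ne_zero_of_mem_rootSpace (LieSubalgebra.isNonZero_coe_root η)
    (LieSubalgebra.isNonZero_coe_root φ) ?_ hx hy hx0 hy0⟩
  · rw [hχ]
    exact lie_mem_genWeightSpace_of_mem_genWeightSpace hx hy
  · rw [← hχ]
    exact χ.1.genWeightSpace_ne_bot

/-- A nonzero subspace of `g_{kβ}` that is stable under the Levi factor is all of it. -/
lemma betaSpace_le_of_ne_bot {j : b.support} {k : ℤ} (hk : k ≠ 0)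
    {N : LieSubmodule ℂ (levi b j) L} (hN : N ≠ ⊥) (hNk : N ≤ betaSpace b j k) :
    betaSpace b j k ≤ N := by
  obtain ⟨φ, hφ, hφN⟩ := exists_rootSpace_le hN (Int.cast_ne_zero.mpr hk)
    fun z hz ↦ mem_betaSpace.mp (hNk hz)
  replace hφ : coeff b φ j = k := Int.cast_injective hφ
  refine fun z hz ↦ betaSpace_le hk (restrictCartan N) (fun χ hχ ↦ ?_) hz
  -- The roots whose root spaces lie in `N` are closed under adding roots of level zero, as the
  -- latter have their root vectors in the Levi factor. Connectedness of level `k` then gives all of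
  -- it.
  refine b.mem_of_rootCoeff_eq j {φ : H.root | rootSpace H φ.1 ≤ restrictCartan N} ?_ hφN
    (hφ.trans_ne hk) (hχ.trans hφ.symm)
  intro φ hφ η hη χ hχ
  obtain ⟨x, hx, y, hy, hxy, hxy0⟩ := exists_lie_ne_zero hχ
  have hxl : x ∈ levi b j := rootSpace_le_levi hη hx
  exact rootSpace_le_of_mem (LieSubalgebra.isNonZero_coe_root χ) _ (N.lie_mem (x := ⟨x, hxl⟩) (hφ hy)) hxy hxy0

end TRoots

/-! ### The nilradical of the parabolic subalgebra -/

namespace TRoots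

variable {L : Type*} [LieRing L] [LieAlgebra ℂ L] [FiniteDimensional ℂ L]
  [LieAlgebra.IsSimple ℂ L] {H : LieSubalgebra ℂ L} [H.IsCartanSubalgebra]
  {b : (rootSystem H).Base}

lemma lie_mem_grade {j : b.support} {k l : ℕ} {x y : L} (hx : x ∈ grade b j k)
    (hy : y ∈ grade b j l) : ⁅x, y⁆ ∈ grade b j (k + l) := by
  rw [mem_grade] at hx hy ⊢
  rw [leibniz_lie, hx, hy, smul_lie, lie_smul, Nat.cast_add, add_smul]

/-- The sum of the eigenspaces of `ad x_j` for the integral eigenvalues at least `n ≥ 0`. -/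
noncomputable def upper (b : (rootSystem H).Base) (j : b.support) (n : ℕ) : Submodule ℂ L :=
  ⨆ k : ℕ, grade b j (n + k)

lemma lie_mem_upper {j : b.support} {m n : ℕ} {x y : L} (hx : x ∈ upper b j m)
    (hy : y ∈ upper b j n) : ⁅x, y⁆ ∈ upper b j (m + n) := by
  induction hx using Submodule.iSup_induction' with
  | zero => rw [zero_lie]; exact zero_mem _
  | add x₁ x₂ _ _ h₁ h₂ => rw [add_lie]; exact add_mem h₁ h₂
  | mem k x hx =>
    induction hy using Submodule.iSup_induction' with
    | zero => rw [lie_zero]; exact zero_mem _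
    | add y₁ y₂ _ _ h₁ h₂ => rw [lie_add]; exact add_mem h₁ h₂
    | mem l y hy =>
      refine Submodule.mem_iSup_of_mem (k + l) ?_
      rw [add_add_add_comm]
      exact lie_mem_grade hx hy

lemma mem_parabolic {j : b.support} {z : L} : z ∈ parabolic b j ↔ z ∈ upper b j 0 := by
  change z ∈ (⨆ k : ℕ, grade b j k : Submodule ℂ L) ↔ _
  simp only [upper, zero_add]

lemma mem_grade_iff_mem_betaSpace {j : b.support} {k : ℕ} {z : L} :
    z ∈ grade b j k ↔ z ∈ betaSpace b j k := by
  rw [mem_grade, mem_betaSpace, Int.cast_natCast]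

/-- Every nonzero integral eigenvalue of `ad x_j` is the coefficient of some root, since its
eigenspace contains a root space. -/
lemma betaSpace_eq_bot {j : b.support} {k : ℤ} (hk : k ≠ 0)
    (h : ∀ φ : H.root, coeff b φ j ≠ k) : betaSpace b j k = ⊥ := by
  by_contra hne
  obtain ⟨φ, hφ, -⟩ := exists_rootSpace_le hne (Int.cast_ne_zero.mpr hk)
    fun z hz ↦ mem_betaSpace.mp hz
  exact h φ (Int.cast_injective hφ)

lemma upper_eq_bot {ψ : H.root} (hψ : IsHighestRoot b ψ) (j : b.support) :
    upper b j ((coeff b ψ j).toNat + 1) = ⊥ := by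
  rw [upper, iSup_eq_bot]
  intro k
  rw [Submodule.eq_bot_iff]
  intro z hz
  rw [mem_grade_iff_mem_betaSpace, betaSpace_eq_bot (by lia)] at hz
  · simpa using hz
  · intro φ hφ
    have h : coeff b φ j ≤ coeff b ψ j :=
      RootPairing.Base.IsMaximalRoot.rootCoeff_le (b := b) hψ φ j
    lia

lemma upper_le {j : b.support} {m n : ℕ} (h : m ≤ n) : upper b j n ≤ upper b j m := by
  refine iSup_le fun k ↦ ?_
  obtain ⟨d, rfl⟩ := Nat.exists_eq_add_of_le h
  rw [add_assoc]
  exact le_iSup (fun k ↦ grade b j (m + k)) (d + k)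

/-- The sum of the eigenspaces of `ad x_j` for positive integers, as an ideal of the parabolic
subalgebra. -/
noncomputable def upperIdeal (b : (rootSystem H).Base) (j : b.support) :
    LieIdeal ℂ (parabolic b j) where
  __ := (upper b j 1).comap (parabolic b j).toSubmodule.subtype
  lie_mem {x y} hy := by
    have := lie_mem_upper (mem_parabolic.mp x.2) (show (y : L) ∈ upper b j 1 from hy)
    rw [zero_add] at this
    exact this

/-- By Engel's theorem it is enough that each `ad x` is nilpotent, and `ad x` raises the degree,
which is bounded by `n_j(ψ)`. -/
lemma upperIdeal_isNilpotent {ψ : H.root} (hψ : IsHighestRoot b ψ) (j : b.support) :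
    LieRing.IsNilpotent (upperIdeal b j) := by
  rw [LieAlgebra.isNilpotent_iff_forall (R := ℂ)]
  intro x
  refine ⟨(coeff b ψ j).toNat + 1, LinearMap.ext fun y ↦ ?_⟩
  have key : ∀ n : ℕ, (((ad ℂ (upperIdeal b j) x ^ n) y : parabolic b j) : L) ∈
      upper b j n := by
    intro n
    induction n with
    | zero => exact upper_le zero_le_one y.2
    | succ n ih =>
      rw [pow_succ', add_comm n 1]
      exact lie_mem_upper x.2 ih
  have h := key ((coeff b ψ j).toNat + 1)
  rw [upper_eq_bot hψ, Submodule.mem_bot] at h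
  exact Subtype.ext (Subtype.ext h)

/-- In a nilpotent Lie algebra `ad x` is nilpotent and so has no nonzero eigenvalue. This is the
obstruction that keeps nilpotent ideals of the parabolic subalgebra out of degree zero. -/
lemma eq_zero_of_lie_eq_smul {A : Type*} [LieRing A] [LieAlgebra ℂ A] [FiniteDimensional ℂ A]
    [LieRing.IsNilpotent A]
    {x y : A} {c : ℂ} (hc : c ≠ 0) (h : ⁅x, y⁆ = c • y) : y = 0 := by
  obtain ⟨n, hn⟩ := (LieAlgebra.isNilpotent_iff_forall (R := ℂ) (L := A)).mp inferInstance x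
  have key : ∀ n : ℕ, (ad ℂ A x ^ n) y = c ^ n • y := by
    intro n
    induction n with
    | zero => simp
    | succ n ih => rw [pow_succ', Module.End.mul_apply, ih, map_smul, ad_apply, h, smul_smul,
        pow_succ]
  have := key n
  rw [hn, LinearMap.zero_apply] at this
  exact (smul_eq_zero.mp this.symm).resolve_left (pow_ne_zero n hc)

lemma eq_zero_of_mem_parabolic {j : b.support} {z : L} (hz : z ∈ parabolic b j) {k : ℤ}
    (hk : k < 0) (hzk : ⁅(dualElt b j : L), z⁆ = (k : ℂ) • z) : z = 0 := by
  have hind := Module.End.eigenspaces_iSupIndep (ad ℂ L (dualElt b j : L)) (k : ℂ)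
  refine Submodule.disjoint_def.mp hind z (by simpa using hzk) ?_
  have hle : (⨆ l : ℕ, grade b j l : Submodule ℂ L) ≤
      ⨆ c, ⨆ (_ : c ≠ (k : ℂ)), Module.End.eigenspace (ad ℂ L (dualElt b j : L)) c := by
    refine iSup_le fun l ↦ le_iSup₂_of_le (l : ℂ) ?_ le_rfl
    rw [← Int.cast_natCast, Int.cast_injective.ne_iff]
    lia
  exact hle hz

lemma rootSpace_le_parabolic {φ : H.root} {j : b.support} (hφ : 0 ≤ coeff b φ j) {z : L}
    (hz : z ∈ rootSpace H φ.1) : z ∈ parabolic b j := by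
  refine Submodule.mem_iSup_of_mem (p := grade b j) (coeff b φ j).toNat ?_
  rw [mem_grade_iff_mem_betaSpace, Int.toNat_of_nonneg hφ]
  exact rootSpace_le_betaSpace φ j hz

/-- Every nilpotent ideal of the parabolic subalgebra lies in the sum of the eigenspaces of
`ad x_j` for positive integers. -/
lemma le_upperIdeal_of_isNilpotent {j : b.support} (I : LieIdeal ℂ (parabolic b j))
    (hI : LieRing.IsNilpotent I) : I ≤ upperIdeal b j := by
  let N : LieSubmodule ℂ H L :=
    { (I : Submodule ℂ (parabolic b j)).map (parabolic b j).toSubmodule.subtype with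
      lie_mem := by
        rintro x _ ⟨w, hw, rfl⟩
        exact ⟨⁅(⟨x, levi_le_parabolic b j (cartan_le_levi b j x.2)⟩ : parabolic b j), w⁆,
          lie_mem_right ℂ _ I _ w hw, rfl⟩ }
  have hNq : ∀ z ∈ N, z ∈ parabolic b j := by
    rintro _ ⟨w, -, rfl⟩
    exact w.2
  have hNlie : ∀ x ∈ parabolic b j, ∀ z ∈ N, ⁅z, x⁆ ∈ N := by
    rintro x hx _ ⟨w, hw, rfl⟩
    exact ⟨⁅(show parabolic b j from w), (⟨x, hx⟩ : parabolic b j)⁆, lie_mem_left ℂ _ I w _ hw, rfl⟩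
  have hNnil : ∀ x ∈ N, ∀ y ∈ N, ∀ c : ℂ, c ≠ 0 → ⁅x, y⁆ = c • y → y = 0 := by
    rintro _ ⟨x, hx, rfl⟩ _ ⟨y, hy, rfl⟩ c hc h
    have : (⟨y, hy⟩ : I) = 0 :=
      eq_zero_of_lie_eq_smul (x := (⟨x, hx⟩ : I)) hc (Subtype.ext (Subtype.ext h))
    exact congrArg (fun t : I ↦ ((t : parabolic b j) : L)) this
  -- If `z` in `N ∩ H` is nonzero, some root `φ` has `φ(z) ≠ 0`, and up to sign its root vector `e`
  -- lies in the parabolic subalgebra. Then `[z, e] = φ(z) e` puts `e` into the ideal, where `z` has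
  -- a nonzero eigenvalue on it.
  have hcartan : ∀ z ∈ N, z ∈ H → z = 0 := by
    intro z hzN hz
    by_contra hz0
    have hφ : ∃ φ : H.root, φ.1 ⟨z, hz⟩ ≠ 0 := by
      by_contra! h
      have h' : ∀ f : Module.Dual ℂ H, f ⟨z, hz⟩ = 0 := by
        intro f
        rw [← b.toWeightBasis.sum_repr f, LinearMap.sum_apply]
        refine Finset.sum_eq_zero fun i _ ↦ ?_
        rw [LinearMap.smul_apply, RootPairing.Base.toWeightBasis_apply]
        exact (congrArg _ (h i.1)).trans (smul_zero _)
      exact hz0 (congrArg Subtype.val ((Module.forall_dual_apply_eq_zero_iff ℂ _).mp h'))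
    obtain ⟨φ, hφ, hφ0⟩ : ∃ φ : H.root, φ.1 ⟨z, hz⟩ ≠ 0 ∧ 0 ≤ coeff b φ j := by
      obtain ⟨φ, hφ⟩ := hφ
      rcases le_total 0 (coeff b φ j) with h | h
      · exact ⟨φ, hφ, h⟩
      · let := (rootSystem H).indexNeg
        have hneg : (rootSystem H).root (-φ) = -(rootSystem H).root φ := by
          simp [-rootSystem_root_apply]
        refine ⟨-φ, ?_, ?_⟩
        · change (rootSystem H).root (-φ) ⟨z, hz⟩ ≠ 0
          rw [hneg, LinearMap.neg_apply, neg_ne_zero]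
          exact hφ
        · change 0 ≤ b.rootCoeff j (-φ)
          rw [RootPairing.Base.rootCoeff_neg hneg, neg_nonneg]
          exact h
    obtain ⟨e, he, he0⟩ := φ.1.exists_ne_zero
    have hze : ⁅z, e⁆ = φ.1 ⟨z, hz⟩ • e := lie_eq_smul_of_mem_rootSpace he ⟨z, hz⟩
    have heN : e ∈ N := by
      have := hNlie e (rootSpace_le_parabolic hφ0 he) z hzN
      rw [hze] at this
      simpa [smul_smul, hφ] using N.smul_mem (φ.1 ⟨z, hz⟩)⁻¹ this
    exact he0 (hNnil z hzN e heN _ hφ hze)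
  have hN : ∀ z ∈ N, z ∈ upper b j 1 := by
    let U : LieSubmodule ℂ H L :=
      { upper b j 1 with
        lie_mem := by
          intro x z hz
          have := lie_mem_upper (mem_parabolic.mp (levi_le_parabolic b j
            (cartan_le_levi b j x.2))) hz
          rwa [zero_add] at this }
    suffices N ≤ U from this
    rw [LieModule.eq_iSup_inf_genWeightSpace ℂ H L N]
    refine iSup_le fun χ ↦ ?_
    rintro z ⟨hzN, hz⟩
    rcases eq_or_ne z 0 with rfl | hz0
    · exact zero_mem _
    have hχ : χ.IsNonZero := fun h ↦ hz0 (hcartan z hzN (h.mem_of_mem_rootSpace hz))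
    set φ : H.root := ⟨χ, by simpa using hχ⟩ with hφ
    have hzφ : z ∈ rootSpace H φ.1 := hz
    rcases lt_trichotomy (coeff b φ j) 0 with h | h | h
    · exact absurd (eq_zero_of_mem_parabolic (hNq z hzN) h (lie_dualElt_of_mem_rootSpace hzφ j)) hz0
    · exfalso
      -- At level zero both `e` and `f` lie in the parabolic subalgebra. If the ideal contains `e`,
      -- it contains `k = [e, f]`, and `[k, e] = 2e` contradicts nilpotency.
      obtain ⟨k, e, f, t, he, hf⟩ := exists_isSl2Triple_of_weight_isNonZero hχ
      have heN : e ∈ N := rootSpace_le_of_mem hχ N hzN hz hz0 he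
      have hfq : f ∈ parabolic b j := by
        refine levi_le_parabolic b j ?_
        rw [mem_levi]
        have h₁ := lie_eq_smul_of_mem_rootSpace hf (dualElt b j)
        have h₂ : χ (dualElt b j) = 0 := by
          have := root_apply_dualElt φ j
          rwa [h, Int.cast_zero] at this
        rw [Pi.neg_apply, h₂, neg_zero, zero_smul] at h₁
        exact h₁
      have hkN : k ∈ N := t.lie_e_f ▸ hNlie f hfq e heN
      exact t.e_ne_zero (hNnil k hkN e heN 2 two_ne_zero (t.lie_h_e_smul ℂ))
    · refine Submodule.mem_iSup_of_mem (p := fun k ↦ grade b j (1 + k))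
        ((coeff b φ j).toNat - 1) ?_
      rw [mem_grade_iff_mem_betaSpace,
        show ((1 + ((coeff b φ j).toNat - 1) : ℕ) : ℤ) = coeff b φ j by lia]
      exact rootSpace_le_betaSpace φ j hzφ
  intro z hz
  exact hN z ⟨z, hz, rfl⟩

/-- The nilradical of the parabolic subalgebra is the sum of the eigenspaces of `ad x_j` for
positive integers. -/
lemma mem_nil {ψ : H.root} (hψ : IsHighestRoot b ψ) {j : b.support} {z : L} :
    z ∈ nil b j ↔ z ∈ upper b j 1 := by
  have h : nilradical (parabolic b j) = upperIdeal b j :=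
    le_antisymm (sSup_le fun I hI ↦ le_upperIdeal_of_isNilpotent I hI)
      (le_sSup (upperIdeal_isNilpotent hψ j))
  change z ∈ Submodule.map _ (nilradical (parabolic b j)).toSubmodule ↔ _
  rw [h]
  constructor
  · rintro ⟨w, hw, rfl⟩
    exact hw
  · intro hz
    exact ⟨⟨z, mem_parabolic.mpr (upper_le zero_le_one hz)⟩, hz, rfl⟩

end TRoots

/-! ### Criteria for irreducible and multiplicity-free modules -/

/-- A nonzero Lie submodule without proper nonzero Lie submodules is irreducible. -/
lemma LieSubmodule.isIrreducible_of_forall_le {R A V : Type*} [CommRing R] [LieRing A]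
    [AddCommGroup V] [Module R V] [LieRingModule A V] (N : LieSubmodule R A V) (hN : N ≠ ⊥)
    (h : ∀ N' ≤ N, N' ≠ ⊥ → N ≤ N') : LieModule.IsIrreducible R A N := by
  have : Nontrivial N := (LieSubmodule.nontrivial_iff_ne_bot R A V).mpr hN
  refine LieModule.IsIrreducible.mk fun N' hN' ↦ ?_
  have hne : N'.map N.incl ≠ ⊥ := by
    rw [ne_eq, LieSubmodule.eq_bot_iff] at hN' ⊢
    exact fun h' ↦ hN' fun m hm ↦
      Subtype.ext (h' _ ((LieSubmodule.mem_map _).mpr ⟨m, hm, rfl⟩))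
  rw [eq_top_iff]
  intro x _
  obtain ⟨y, hy, hyx⟩ := (LieSubmodule.mem_map _).mp (h _ (LieSubmodule.map_incl_le) hne x.2)
  have : y = x := Subtype.ext hyx
  exact this ▸ hy

namespace TRoots

/-- A sum of irreducible submodules on which some element of the Lie algebra acts as pairwise
distinct scalars is multiplicity-free. -/
lemma isMultiplicityFreeWith_of_forall_lie_eq_smul {A V : Type*} [LieRing A] [LieAlgebra ℂ A]
    [AddCommGroup V] [Module ℂ V] [LieRingModule A V] [LieModule ℂ A V] {n : ℕ} (x : A)
    {c : Fin n → ℂ} (hc : Function.Injective c) (W : Fin n → LieSubmodule ℂ A V)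
    (hW : ∀ i, ∀ v ∈ W i, ⁅x, v⁆ = c i • v) (hirr : ∀ i, LieModule.IsIrreducible ℂ A (W i))
    (htop : ⨆ i, W i = ⊤) : IsMultiplicityFreeWith A V n := by
  refine ⟨W, ?_, htop, hirr, fun i i' hne ↦ ⟨fun e ↦ ?_⟩⟩
  · rw [← LieSubmodule.iSupIndep_toSubmodule]
    refine ((Module.End.eigenspaces_iSupIndep (LieModule.toEnd ℂ A V x)).comp hc).mono
      fun i v hv ↦ ?_
    exact Module.End.mem_eigenspace_iff.mpr (hW i v hv)
  -- An isomorphism would intertwine the actions of `x`, which are the distinct scalars `c i` and `c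
  -- i'`.
  · have := LieModule.nontrivial_of_isIrreducible ℂ A (W i)
    obtain ⟨v, hv⟩ := exists_ne (0 : W i)
    have h₁ : ⁅x, v⁆ = c i • v := Subtype.ext (hW i v v.2)
    have h₂ : ⁅x, e v⁆ = c i' • e v := Subtype.ext (hW i' (e v) (e v).2)
    have h₃ : e ⁅x, v⁆ = ⁅x, e v⁆ := LieModuleHom.map_lie e.toLieModuleHom x v
    rw [h₁, h₂] at h₃
    have h₄ : c i • e v = c i' • e v := by
      rw [← h₃]
      exact (map_smul (e.toLinearEquiv) (c i) v).symm
    have hev : e v ≠ 0 := fun h ↦ hv (e.injective (h.trans (map_zero e.toLinearEquiv).symm))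
    exact hne (hc (smul_left_injective ℂ hev h₄))

/-- A submodule that is the sum of irreducible submodules, on which some element of the Lie algebra
acts as pairwise distinct scalars, is multiplicity-free. -/
lemma isMultiplicityFreeWith_of_submodule {A V : Type*} [LieRing A] [LieAlgebra ℂ A]
    [AddCommGroup V] [Module ℂ V] [LieRingModule A V] [LieModule ℂ A V] {n : ℕ}
    (M : LieSubmodule ℂ A V) (x : A) {c : Fin n → ℂ} (hc : Function.Injective c)
    (U : Fin n → LieSubmodule ℂ A V) (hUM : ∀ i, U i ≤ M)
    (hU : ∀ i, ∀ v ∈ U i, ⁅x, v⁆ = c i • v) (hne : ∀ i, U i ≠ ⊥)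
    (hirr : ∀ i, ∀ N ≤ U i, N ≠ ⊥ → U i ≤ N) (htop : ∀ v ∈ M, v ∈ ⨆ i, U i) :
    IsMultiplicityFreeWith A M n := by
  have hmap : ∀ i, ((U i).comap M.incl).map M.incl = U i := fun i ↦ by
    rw [LieSubmodule.map_comap_incl, inf_eq_right]
    exact hUM i
  have hinj : ∀ N : LieSubmodule ℂ A M, N.map M.incl = ⊥ → N = ⊥ := fun N h ↦
    (LieSubmodule.eq_bot_iff _).mpr fun y hy ↦ Subtype.ext ((LieSubmodule.eq_bot_iff _).mp h y
      ((LieSubmodule.mem_map _).mpr ⟨y, hy, rfl⟩))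
  refine isMultiplicityFreeWith_of_forall_lie_eq_smul x hc (fun i ↦ (U i).comap M.incl)
    (fun i v hv ↦ Subtype.ext (hU i v hv))
    (fun i ↦ LieSubmodule.isIrreducible_of_forall_le _ (fun h ↦ hne i ?_) fun N hN hN0 z hz ↦ ?_) ?_
  · rw [← hmap i, h, LieSubmodule.map_bot]
  · obtain ⟨y, hy, hyz⟩ := (LieSubmodule.mem_map _).mp
      (hirr i (N.map M.incl) (LieSubmodule.map_le_iff_le_comap.mpr hN) (fun h ↦ hN0 (hinj N h)) hz)
    exact (Subtype.ext hyz : y = z) ▸ hy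
  · rw [eq_top_iff]
    rintro v -
    have h := htop v v.2
    rw [← iSup_congr hmap, ← LieSubmodule.map_iSup] at h
    obtain ⟨y, hy, hyv⟩ := (LieSubmodule.mem_map _).mp h
    exact (Subtype.ext hyv : y = v) ▸ hy

/-- If a module is the sum of a submodule `M` and irreducible submodules that meet `M` trivially, and
on which some element of the Lie algebra acts as pairwise distinct scalars, then the quotient by `M`
is multiplicity-free. -/
lemma isMultiplicityFreeWith_quotient {A V : Type*} [LieRing A] [LieAlgebra ℂ A]
    [AddCommGroup V] [Module ℂ V] [LieRingModule A V] [LieModule ℂ A V] {n : ℕ}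
    (M : LieSubmodule ℂ A V) (x : A) {c : Fin n → ℂ} (hc : Function.Injective c)
    (U : Fin n → LieSubmodule ℂ A V) (hUM : ∀ i, Disjoint (U i) M)
    (hU : ∀ i, ∀ v ∈ U i, ⁅x, v⁆ = c i • v) (hne : ∀ i, U i ≠ ⊥)
    (hirr : ∀ i, ∀ N ≤ U i, N ≠ ⊥ → U i ≤ N) (htop : ∀ v, v ∈ M ⊔ ⨆ i, U i) :
    IsMultiplicityFreeWith A (V ⧸ M) n := by
  let π : V →ₗ⁅ℂ, A⁆ (V ⧸ M) := LieSubmodule.Quotient.mk' M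
  have hπ : ∀ v, π v = 0 ↔ v ∈ M := fun v ↦ LieSubmodule.Quotient.mk_eq_zero M
  refine isMultiplicityFreeWith_of_forall_lie_eq_smul x hc (fun i ↦ (U i).map π)
    (fun i v hv ↦ ?_)
    (fun i ↦ LieSubmodule.isIrreducible_of_forall_le _ (fun h ↦ hne i ?_) fun N hN hN0 ↦ ?_) ?_
  · obtain ⟨z, hz, rfl⟩ := (LieSubmodule.mem_map _).mp hv
    rw [← LieModuleHom.map_lie, hU i z hz, map_smul]
  · refine (LieSubmodule.eq_bot_iff _).mpr fun z hz ↦ ?_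
    have h₁ := (LieSubmodule.eq_bot_iff _).mp h _ ((LieSubmodule.mem_map _).mpr ⟨z, hz, rfl⟩)
    have h₂ := (LieSubmodule.eq_bot_iff _).mp (disjoint_iff.mp (hUM i))
    exact h₂ z ⟨hz, (hπ z).mp h₁⟩
  -- `π` is not assumed injective, so the preimage of `N` is cut down to `U i` before minimality of
  -- `U i` is applied.
  · have hne' : N.comap π ⊓ U i ≠ ⊥ := fun h ↦
      hN0 ((LieSubmodule.eq_bot_iff _).mpr fun y hy ↦ by
        obtain ⟨z, hz, rfl⟩ := (LieSubmodule.mem_map _).mp (hN hy)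
        rw [(LieSubmodule.eq_bot_iff _).mp h z ⟨hy, hz⟩, map_zero])
    exact LieSubmodule.map_le_iff_le_comap.mpr ((hirr i _ inf_le_right hne').trans inf_le_left)
  · rw [eq_top_iff]
    rintro v -
    obtain ⟨z, rfl⟩ := LieSubmodule.Quotient.surjective_mk' M v
    obtain ⟨y, hy, w, hw, rfl⟩ := (LieSubmodule.mem_sup _ _ _).mp (htop z)
    rw [map_add, show LieSubmodule.Quotient.mk' M y = 0 from (hπ y).mpr hy, zero_add,
      ← LieSubmodule.map_iSup]
    exact (LieSubmodule.mem_map _).mpr ⟨w, hw, rfl⟩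

/-! ### Irreducibility of the spaces `g_{kβ}` -/

variable {L : Type*} [LieRing L] [LieAlgebra ℂ L] [FiniteDimensional ℂ L]
  [LieAlgebra.IsSimple ℂ L] {H : LieSubalgebra ℂ L} [H.IsCartanSubalgebra]
  {b : (rootSystem H).Base}

lemma coeff_pos {ψ : H.root} (hψ : IsHighestRoot b ψ) (j : b.support) : 0 < coeff b ψ j :=
  RootPairing.Base.IsMaximalRoot.rootCoeff_pos (b := b) hψ j

lemma coeff_mem_indexSet {ψ : H.root} (hψ : IsHighestRoot b ψ) {j : b.support} {φ : H.root}
    (h : coeff b φ j ≠ 0) : coeff b φ j ∈ indexSet b ψ j :=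
  ⟨h, RootPairing.Base.IsMaximalRoot.abs_rootCoeff_le (b := b) hψ φ j⟩

lemma exists_coeff_eq {ψ : H.root} {j : b.support} {k : ℤ} (hk : k ∈ indexSet b ψ j) :
    ∃ φ : H.root, coeff b φ j = k :=
  b.exists_rootCoeff_eq j hk.1 hk.2

lemma betaSpace_ne_bot_of_mem {ψ : H.root} {j : b.support} {k : ℤ} (hk : k ∈ indexSet b ψ j) :
    betaSpace b j k ≠ ⊥ := by
  obtain ⟨φ, rfl⟩ := exists_coeff_eq hk
  exact betaSpace_ne_bot φ j

lemma betaSpace_isIrreducible {ψ : H.root} {j : b.support} {k : ℤ} (hk : k ∈ indexSet b ψ j) :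
    LieModule.IsIrreducible ℂ (levi b j) (betaSpace b j k) :=
  LieSubmodule.isIrreducible_of_forall_le _ (betaSpace_ne_bot_of_mem hk) fun _ hN hN0 ↦
    betaSpace_le_of_ne_bot hk.1 hN0 hN

/-! ### The roots of the center of the Levi factor -/

lemma roots_levi_eq {ψ : H.root} (hψ : IsHighestRoot b ψ) (j : b.support) :
    roots (levi b j) = {ν | ∃ k ∈ indexSet b ψ j, ν = k • beta b j} := by
  ext ν
  constructor
  · rintro ⟨hν0, hν⟩
    have hc : ν (centerElt b j) ≠ 0 := fun h ↦ hν0 (by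
      rw [dual_eq_smul_beta j ν, h, zero_smul])
    obtain ⟨φ, hφ, -⟩ := exists_rootSpace_le hν hc fun z hz ↦ mem_weightSpace_levi.mp hz
    refine ⟨coeff b φ j, coeff_mem_indexSet hψ fun h ↦ hc ?_, ?_⟩
    · rw [← hφ, h, Int.cast_zero]
    · rw [dual_eq_smul_beta j ν, ← hφ, Int.cast_smul_eq_zsmul]
  · rintro ⟨k, hk, rfl⟩
    refine ⟨fun h ↦ hk.1 (zsmul_beta_injective (b := b) j ?_), betaSpace_ne_bot_of_mem hk⟩
    simpa using h

lemma betaSpace_le_nil {ψ : H.root} (hψ : IsHighestRoot b ψ) {j : b.support} {k : ℤ}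
    (hk : 0 < k) : betaSpace b j k ≤ nil b j := by
  intro z hz
  rw [mem_nil hψ]
  refine Submodule.mem_iSup_of_mem (p := fun l ↦ grade b j (1 + l)) (k.toNat - 1) ?_
  rwa [mem_grade_iff_mem_betaSpace, show ((1 + (k.toNat - 1) : ℕ) : ℤ) = k by lia]

lemma posRoots_levi_eq {ψ : H.root} (hψ : IsHighestRoot b ψ) (j : b.support) :
    posRoots (levi b j) (nil b j) =
      {ν | ∃ k : ℤ, 1 ≤ k ∧ k ≤ coeff b ψ j ∧ ν = k • beta b j} := by
  ext ν
  rw [posRoots, Set.mem_ofPred_eq, roots_levi_eq hψ]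
  constructor
  · rintro ⟨⟨k, hk, rfl⟩, hle⟩
    have hk' := hk.2
    refine ⟨k, ?_, by rw [abs_le] at hk'; exact hk'.2, rfl⟩
    by_contra! hlt
    -- For `k < 0` the space `g_{kβ}` would lie in the sum of the positive eigenspaces and at the
    -- same time have a negative eigenvalue, so it would be zero.
    refine betaSpace_ne_bot_of_mem hk ((LieSubmodule.eq_bot_iff _).mpr fun z hz ↦ ?_)
    have hzn : z ∈ upper b j 1 := (mem_nil hψ).mp (hle hz)
    exact eq_zero_of_mem_parabolic (mem_parabolic.mpr (upper_le zero_le_one hzn))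
      (lt_of_le_of_ne (by lia) hk.1) (mem_betaSpace.mp hz)
  · rintro ⟨k, hk1, hk, rfl⟩
    exact ⟨⟨k, ⟨by lia, by rwa [abs_of_pos (by lia)]⟩, rfl⟩, betaSpace_le_nil hψ (by lia)⟩

lemma simpleRoots_levi_eq {ψ : H.root} (hψ : IsHighestRoot b ψ) (j : b.support) :
    simpleRoots (levi b j) (nil b j) = {beta b j} := by
  ext ν
  rw [simpleRoots, Set.mem_ofPred_eq, posRoots_levi_eq hψ, Set.mem_singleton_iff]
  have hpos := coeff_pos hψ j
  constructor
  · rintro ⟨⟨k, hk1, hk, rfl⟩, hsum⟩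
    rcases hk1.eq_or_lt with rfl | hk1
    · exact one_zsmul _
    · refine absurd ⟨1 • beta b j, ⟨1, le_rfl, hpos, by simp⟩, (k - 1) • beta b j,
        ⟨k - 1, by lia, by lia, rfl⟩, ?_⟩ hsum
      module
  · rintro rfl
    refine ⟨⟨1, le_rfl, hpos, (one_zsmul _).symm⟩, ?_⟩
    rintro ⟨_, ⟨k, hk, -, rfl⟩, _, ⟨l, hl, -, rfl⟩, h⟩
    rw [← add_zsmul] at h
    have : 1 = k + l := zsmul_beta_injective (b := b) j (by simpa using h)
    lia

lemma ncard_posRoots_levi {ψ : H.root} (hψ : IsHighestRoot b ψ) (j : b.support) :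
    ((posRoots (levi b j) (nil b j)).ncard : ℤ) = coeff b ψ j := by
  have h : posRoots (levi b j) (nil b j) =
      (fun k : ℤ ↦ k • beta b j) '' (Finset.Icc 1 (coeff b ψ j) : Finset ℤ) := by
    rw [posRoots_levi_eq hψ]
    ext ν
    simp [and_assoc, eq_comm]
  rw [h, Set.ncard_image_of_injective _ (zsmul_beta_injective j), Set.ncard_coe_finset,
    Int.card_Icc]
  have := coeff_pos hψ j
  lia

lemma ncard_roots_levi {ψ : H.root} (hψ : IsHighestRoot b ψ) (j : b.support) :
    ((roots (levi b j)).ncard : ℤ) = 2 * coeff b ψ j := by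
  have h : roots (levi b j) = (fun k : ℤ ↦ k • beta b j) ''
      ((Finset.Icc (-coeff b ψ j) (coeff b ψ j)).erase 0 : Finset ℤ) := by
    rw [roots_levi_eq hψ]
    ext ν
    simp [indexSet, abs_le, eq_comm, and_comm]
  have hpos := coeff_pos hψ j
  rw [h, Set.ncard_image_of_injective _ (zsmul_beta_injective j), Set.ncard_coe_finset,
    Finset.card_erase_of_mem (by simp [hpos.le]), Int.card_Icc]
  lia

/-! ### Brackets -/

/-- The span of the brackets of two subspaces that are stable under a subalgebra. -/
def bracketSubmodule {m : LieSubalgebra ℂ L} (U V : LieSubmodule ℂ m L) : LieSubmodule ℂ m L where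
  __ := bracketSpan (U : Submodule ℂ L) (V : Submodule ℂ L)
  lie_mem {y z} hz := by
    change z ∈ bracketSpan (U : Submodule ℂ L) (V : Submodule ℂ L) at hz
    change ⁅(y : L), z⁆ ∈ bracketSpan (U : Submodule ℂ L) (V : Submodule ℂ L)
    induction hz using Submodule.span_induction with
    | mem z hz =>
      obtain ⟨u, hu, v, hv, rfl⟩ := hz
      rw [leibniz_lie]
      exact add_mem (Submodule.subset_span ⟨_, U.lie_mem (x := y) hu, v, hv, rfl⟩)
        (Submodule.subset_span ⟨u, hu, _, V.lie_mem (x := y) hv, rfl⟩)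
    | zero => rw [lie_zero]; exact zero_mem _
    | add z w _ _ hz hw => rw [lie_add]; exact add_mem hz hw
    | smul c z _ hz => rw [lie_smul]; exact Submodule.smul_mem _ c hz

/-- As `p` and `p + q` have the same sign, there are roots on these two levels whose difference is a
root. That root lies on level `q`, and root vectors whose roots add up to a root have nonzero
bracket. -/
lemma exists_lie_betaSpace_ne_zero {ψ : H.root} {j : b.support} {p q : ℤ}
    (hp : p ∈ indexSet b ψ j) (hq : q ≠ 0) (hr : p + q ∈ indexSet b ψ j)
    (hpr : 0 < p * (p + q)) :
    ∃ x ∈ betaSpace b j p, ∃ y ∈ betaSpace b j q, ⁅x, y⁆ ≠ 0 := by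
  obtain ⟨φ, hφ⟩ := exists_coeff_eq hp
  obtain ⟨χ, hχ⟩ := exists_coeff_eq hr
  obtain ⟨γ, δ, η, hγ, hδ, hη⟩ := b.exists_root_sub_root j (i := χ) (i' := φ)
    (by change 0 < coeff b χ j * coeff b φ j; rw [hφ, hχ, mul_comm]; exact hpr)
    (by change coeff b χ j ≠ coeff b φ j; rw [hφ, hχ]; simpa using hq)
  have hδp : coeff b δ j = p := hδ.trans hφ
  have hηq : coeff b η j = q := by
    have h₁ : coeff b η j = coeff b γ j - coeff b δ j := RootPairing.Base.rootCoeff_sub hη j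
    have h₂ : coeff b γ j = p + q := hγ.trans hχ
    lia
  obtain ⟨x, hx, y, hy, -, hxy⟩ := exists_lie_ne_zero (φ := η) (η := δ) (χ := γ) (by
    rw [hη, sub_add_cancel])
  exact ⟨x, hδp ▸ rootSpace_le_betaSpace δ j hx, y, hηq ▸ rootSpace_le_betaSpace η j hy, hxy⟩

lemma bracketSpan_betaSpace {ψ : H.root} {j : b.support} {p q : ℤ}
    (hp : p ∈ indexSet b ψ j) (hq : q ∈ indexSet b ψ j) (hr : p + q ∈ indexSet b ψ j) :
    bracketSpan (betaSpace b j p : Submodule ℂ L) (betaSpace b j q : Submodule ℂ L) =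
      (betaSpace b j (p + q) : Submodule ℂ L) := by
  have hle : bracketSubmodule (betaSpace b j p) (betaSpace b j q) ≤ betaSpace b j (p + q) := by
    intro z hz
    refine (Submodule.span_le (p := (betaSpace b j (p + q) : Submodule ℂ L))).mpr ?_ hz
    rintro _ ⟨u, hu, v, hv, rfl⟩
    have hu' := mem_betaSpace.mp hu
    have hv' := mem_betaSpace.mp hv
    refine mem_betaSpace.mpr ?_
    rw [leibniz_lie, hu', hv', smul_lie, lie_smul, ← add_smul, Int.cast_add]
  obtain ⟨x, hx, y, hy, hxy⟩ :
      ∃ x ∈ betaSpace b j p, ∃ y ∈ betaSpace b j q, ⁅x, y⁆ ≠ 0 := by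
    -- The sum is `(p + q)^2 > 0`, so at least one of `p` and `q` has the sign of `p + q`; the other
    -- case follows by antisymmetry of the bracket.
    have hpos : 0 < p * (p + q) + q * (p + q) := by
      rw [← add_mul]
      exact mul_self_pos.mpr hr.1
    by_cases hpr : 0 < p * (p + q)
    · exact exists_lie_betaSpace_ne_zero hp hq.1 hr hpr
    · obtain ⟨y, hy, x, hx, hxy⟩ := exists_lie_betaSpace_ne_zero (p := q) (q := p) hq hp.1
        (by rwa [add_comm]) (by rw [add_comm q p]; lia)
      refine ⟨x, hx, y, hy, fun h ↦ hxy ?_⟩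
      rw [← lie_skew, h, neg_zero]
  have hne : bracketSubmodule (betaSpace b j p) (betaSpace b j q) ≠ ⊥ := fun h ↦
    hxy ((LieSubmodule.eq_bot_iff _).mp h _ (Submodule.subset_span ⟨x, hx, y, hy, rfl⟩))
  exact congrArg LieSubmodule.toSubmodule
    (le_antisymm hle (betaSpace_le_of_ne_bot hr.1 hne hle))

/-! ### The nilradical and the quotient by the Levi factor -/

lemma lie_centerElt_of_mem_betaSpace {j : b.support} {k : ℤ} {z : L} (hz : z ∈ betaSpace b j k) :
    ⁅(centerElt b j : levi b j), z⁆ = (k : ℂ) • z := by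
  rw [LieSubalgebra.coe_bracket_of_module, coe_centerElt, mem_betaSpace.mp hz]

lemma nil_isMultiplicityFreeWith {ψ : H.root} (hψ : IsHighestRoot b ψ) (j : b.support) :
    IsMultiplicityFreeWith (levi b j) (nil b j) (coeff b ψ j).toNat := by
  have hidx : ∀ i : Fin (coeff b ψ j).toNat, ((i : ℤ) + 1) ∈ indexSet b ψ j := fun i ↦ by
    have := i.2
    exact ⟨by lia, by rw [abs_of_pos (by lia)]; lia⟩
  refine isMultiplicityFreeWith_of_submodule (nil b j) (centerElt b j : levi b j)
    (c := fun i ↦ (((i : ℤ) + 1 : ℤ) : ℂ)) (fun i i' h ↦ ?_)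
    (fun i ↦ betaSpace b j ((i : ℤ) + 1)) (fun i ↦ betaSpace_le_nil hψ (by lia))
    (fun i z hz ↦ lie_centerElt_of_mem_betaSpace hz) (fun i ↦ betaSpace_ne_bot_of_mem (hidx i))
    (fun i N hN hN0 ↦ betaSpace_le_of_ne_bot (hidx i).1 hN0 hN) fun z hz ↦ ?_
  · exact Fin.ext (by have : ((i : ℤ) + 1) = (i' : ℤ) + 1 := Int.cast_injective h; lia)
  · rw [mem_nil hψ] at hz
    induction hz using Submodule.iSup_induction' with
    | zero => exact zero_mem _
    | add x y _ _ hx hy => exact add_mem hx hy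
    | mem k z hz =>
      rw [mem_grade_iff_mem_betaSpace] at hz
      by_cases hk : k < (coeff b ψ j).toNat
      · refine LieSubmodule.mem_iSup_of_mem ⟨k, hk⟩ ?_
        rwa [Nat.cast_add, Nat.cast_one, add_comm] at hz
      · rw [betaSpace_eq_bot (by lia) fun φ hφ ↦ ?_] at hz
        · rw [(LieSubmodule.mem_bot z).mp hz]
          exact zero_mem _
        · have := (coeff_mem_indexSet hψ (φ := φ) (j := j) (by lia)).2
          rw [abs_le] at this
          lia

lemma quotient_levi_isMultiplicityFreeWith {ψ : H.root} (hψ : IsHighestRoot b ψ) (j : b.support) :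
    IsMultiplicityFreeWith (levi b j) (L ⧸ (levi b j).toLieSubmodule)
      (2 * (coeff b ψ j).toNat) := by
  set n := (coeff b ψ j).toNat with hn
  have hn' : (n : ℤ) = coeff b ψ j := Int.toNat_of_nonneg (coeff_pos hψ j).le
  -- The first `n` indices enumerate `1, …, n` and the last `n` enumerate `-1, …, -n`.
  set idx : Fin (2 * n) → ℤ := fun i ↦ if (i : ℕ) < n then (i : ℤ) + 1 else n - 1 - i with hidx_def
  have hidx : ∀ i, idx i ∈ indexSet b ψ j := fun i ↦ by
    have := i.2
    simp only [hidx_def, indexSet, Set.mem_ofPred_eq, ← hn', abs_le]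
    split_ifs <;> lia
  have hinj : Function.Injective idx := fun i i' h ↦ by
    simp only [hidx_def] at h
    refine Fin.ext ?_
    split_ifs at h <;> lia
  have hsurj : ∀ k ∈ indexSet b ψ j, ∃ i, idx i = k := by
    rintro k ⟨hk0, hk⟩
    rw [← hn', abs_le] at hk
    rcases lt_or_gt_of_ne hk0 with h | h
    · refine ⟨⟨(n - 1 - k).toNat, by lia⟩, ?_⟩
      simp only [hidx_def]
      split_ifs <;> lia
    · refine ⟨⟨(k - 1).toNat, by lia⟩, ?_⟩
      simp only [hidx_def]
      split_ifs <;> lia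
  refine isMultiplicityFreeWith_quotient _ (centerElt b j : levi b j)
    (c := fun i ↦ ((idx i : ℤ) : ℂ)) (Int.cast_injective.comp hinj) (fun i ↦ betaSpace b j (idx i))
    (fun i ↦ ?_) (fun i z hz ↦ lie_centerElt_of_mem_betaSpace hz) (fun i ↦ betaSpace_ne_bot_of_mem (hidx i))
    (fun i N hN hN0 ↦ betaSpace_le_of_ne_bot (hidx i).1 hN0 hN) fun z ↦ ?_
  · rw [disjoint_iff, LieSubmodule.eq_bot_iff]
    rintro z ⟨hz, hzl⟩
    have h₁ := mem_betaSpace.mp hz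
    rw [mem_levi.mp hzl] at h₁
    exact (smul_eq_zero.mp h₁.symm).resolve_left (Int.cast_ne_zero.mpr (hidx i).1)
  -- `L` is the sum of its root spaces, the zero one included. Those of weight zero or level zero
  -- lie in the Levi factor, and every other one lies in some `g_{kβ}` with `k ≠ 0`.
  · have hz : z ∈ ⨆ χ : LieModule.Weight ℂ H L, rootSpace H χ :=
      (LieModule.iSup_genWeightSpace_eq_top' ℂ H L).symm ▸ LieSubmodule.mem_top z
    induction hz using LieSubmodule.iSup_induction' with
    | zero => exact zero_mem _
    | add x y _ _ hx hy => exact add_mem hx hy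
    | mem χ z hz =>
      by_cases hzl : z ∈ levi b j
      · exact LieSubmodule.mem_sup_left hzl
      · have hχ : χ.IsNonZero := fun h ↦ hzl (cartan_le_levi b j (h.mem_of_mem_rootSpace hz))
        set φ : H.root := ⟨χ, by simpa using hχ⟩ with hφ
        have hφ0 : coeff b φ j ≠ 0 := fun h ↦ hzl (rootSpace_le_levi h hz)
        obtain ⟨i, hi⟩ := hsurj _ (coeff_mem_indexSet hψ hφ0)
        refine LieSubmodule.mem_sup_right (LieSubmodule.mem_iSup_of_mem i ?_)
        rw [hi]
        exact rootSpace_le_betaSpace φ j hz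

end TRoots

theorem theorem3p2 {L : Type*} [LieRing L] [LieAlgebra ℂ L] [FiniteDimensional ℂ L]
    [LieAlgebra.IsSimple ℂ L] (H : LieSubalgebra ℂ L) [H.IsCartanSubalgebra]
    (b : (rootSystem H).Base) (ψ : H.root) (hψ : TRoots.IsHighestRoot b ψ) (j : b.support) :
    -- the `t`-roots
    (TRoots.simpleRoots (TRoots.levi b j) (TRoots.nil b j) = {TRoots.beta b j} ∧
      TRoots.posRoots (TRoots.levi b j) (TRoots.nil b j) =
        {ν | ∃ k : ℤ, 1 ≤ k ∧ k ≤ TRoots.coeff b ψ j ∧ ν = k • TRoots.beta b j} ∧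
      TRoots.roots (TRoots.levi b j) =
        {ν | ∃ k ∈ TRoots.indexSet b ψ j, ν = k • TRoots.beta b j} ∧
      ((TRoots.posRoots (TRoots.levi b j) (TRoots.nil b j)).ncard : ℤ) = TRoots.coeff b ψ j ∧
      ((TRoots.roots (TRoots.levi b j)).ncard : ℤ) = 2 * TRoots.coeff b ψ j) ∧
    -- irreducibility of the `t`-root spaces
    (∀ k ∈ TRoots.indexSet b ψ j,
      LieModule.IsIrreducible ℂ (TRoots.levi b j) (TRoots.betaSpace b j k)) ∧
    -- the nilradical and `g / m[j]` as `ad m[j]`-modules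
    TRoots.IsMultiplicityFreeWith (TRoots.levi b j) (TRoots.nil b j)
      (TRoots.coeff b ψ j).toNat ∧
    TRoots.IsMultiplicityFreeWith (TRoots.levi b j) (L ⧸ (TRoots.levi b j).toLieSubmodule)
      (2 * (TRoots.coeff b ψ j).toNat) ∧
    -- brackets
    (∀ p ∈ TRoots.indexSet b ψ j, ∀ q ∈ TRoots.indexSet b ψ j,
      p + q ∈ TRoots.indexSet b ψ j →
        TRoots.bracketSpan (TRoots.betaSpace b j p : Submodule ℂ L)
          (TRoots.betaSpace b j q : Submodule ℂ L) =
          (TRoots.betaSpace b j (p + q) : Submodule ℂ L)) := by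
  exact ⟨⟨TRoots.simpleRoots_levi_eq hψ j, TRoots.posRoots_levi_eq hψ j, TRoots.roots_levi_eq hψ j,
      TRoots.ncard_posRoots_levi hψ j, TRoots.ncard_roots_levi hψ j⟩,
    fun _ hk ↦ TRoots.betaSpace_isIrreducible hk, TRoots.nil_isMultiplicityFreeWith hψ j,
    TRoots.quotient_levi_isMultiplicityFreeWith hψ j,
    fun _ hp _ hq hr ↦ TRoots.bracketSpan_betaSpace hp hq hr⟩
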